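/- Let $H^p$ ($1\le p<\infty$) be the Hardy space of holomorphic functions $g$ on the open unit disk with $\|g\|_{H^p}=\sup_{0<r<1}\big(\int_0^{2\pi}|g(re^{i\theta})|^p\frac{d\theta}{2\pi}\big)^{1/p}<\infty$. Let $\{X_n\}_{n\ge0}$ be a real centered Gaussian process on a probability space $(\Omega,\mathcal F,P)$, that is, every finite subfamily is jointly Gaussian (possibly degenerate) and $\mathbb E X_n=0$ for all $n$. For $f(z)=\sum_{n\ge0}a_nz^n\in H^2$ let $(\mathcal Rf)(z)=\sum_{n\ge0}a_nX_nz^n$; "$\mathcal Rf\in H^p$" means that this power series converges on the open unit disk and its sum is in $H^p$. Let $L^2(\Omega,H^p)$ be the space of random vectors $F$ in $H^p$ with $\|F\|_{L^2(\Omega,H^p)}^2=\mathbb E\|F\|_{H^p}^2<\infty$. The operator $\mathcal R:H^2\to L^2(\Omega,H^p)$ is called bounded if, for every $f\in H^2$, $\mathcal Rf\in H^p$ almost surely and $\mathcal Rf$ defines an element of $L^2(\Omega,H^p)$, and there is a constant $C<\infty$ with $\|\mathcal Rf\|_{L^2(\Omega,H^p)}\le C\|f\|_{H^2}$ for all $f\in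 H^2$. Then: (1) For every $p\in[1,\infty)$: for each $f\in H^2$ one has $\mathcal Rf\in H^p$ almost surely (the exceptional null set may depend on $f$), if and only if $\mathcal R:H^2\to L^2(\Omega,H^p)$ is bounded. (2) If the covariance matrix $K=\big(\mathbb E(X_mX_n)\big)_{m,n\ge0}$ defines a bounded linear operator on $\ell^2$, then $\mathcal R:H^2\to L^2(\Omega,H^p)$ is bounded for every $p\in[1,\infty)$. -/

import Mathlib

open MeasureTheory ProbabilityTheory
open scoped ENNReal NNReal

noncomputable section

/-- Normalized arc length `dθ / 2π` on `(0, 2π]`. -/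
def arcMeasure : Measure ℝ :=
  ENNReal.ofReal (2 * Real.pi)⁻¹ • volume.restrict (Set.Ioc 0 (2 * Real.pi))

/-- The Hardy norm `sup_{0 < r < 1} (∫ |f (r e^{iθ})|^p dθ / 2π)^{1/p}`, possibly infinite.
Only the values of `f` on the open unit disk matter. -/
def hardyNorm (p : ℝ≥0∞) (f : ℂ → ℂ) : ℝ≥0∞ :=
  ⨆ r ∈ Set.Ioo (0 : ℝ) 1, eLpNorm (fun θ : ℝ => f (circleMap 0 r θ)) p arcMeasure

/-- `f` belongs to the Hardy space `H^p` of the open unit disk. -/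
structure MemHardy (p : ℝ≥0∞) (f : ℂ → ℂ) : Prop where
  holomorphic : DifferentiableOn ℂ f (Metric.ball 0 1)
  norm_lt_top : hardyNorm p f < ∞

/-- The `n`-th Taylor coefficient of `f` at the origin. -/
def taylorCoeff (f : ℂ → ℂ) (n : ℕ) : ℂ :=
  iteratedDeriv n f 0 / (n.factorial : ℂ)

section Randomization

variable {Ω : Type*} [MeasurableSpace Ω]

/-- The `n`-th term of the random power series `∑ a_n X_n(ω) z^n`, where `f = ∑ a_n z^n`. -/
def randomTerm (X : ℕ → Ω → ℝ) (f : ℂ → ℂ) (ω : Ω) (z : ℂ) (n : ℕ) : ℂ :=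
  taylorCoeff f n * (X n ω : ℂ) * z ^ n

/-- The randomization `(R f)(z) = ∑ a_n X_n(ω) z^n` of `f = ∑ a_n z^n`. -/
def randomization (X : ℕ → Ω → ℝ) (f : ℂ → ℂ) (ω : Ω) (z : ℂ) : ℂ :=
  ∑' n, randomTerm X f ω z n

/-- `R f ∈ H^p` for the outcome `ω`: the power series converges in the whole open unit disk and
its sum belongs to `H^p`. -/
def RandomizationMemHardy (X : ℕ → Ω → ℝ) (p : ℝ≥0∞) (f : ℂ → ℂ) (ω : Ω) : Prop :=
  (∀ z ∈ Metric.ball (0 : ℂ) 1, Summable (randomTerm X f ω z)) ∧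
    MemHardy p (randomization X f ω)

/-- `R f ∈ H^p` almost surely, for every `f ∈ H²` (the null set may depend on `f`). -/
def HasLpProperty (X : ℕ → Ω → ℝ) (P : Measure Ω) (p : ℝ≥0∞) : Prop :=
  ∀ f : ℂ → ℂ, MemHardy 2 f → ∀ᵐ ω ∂P, RandomizationMemHardy X p f ω

/-- The norm `(E ‖F‖_{H^p}^q)^{1/q}` of a random function, possibly infinite. -/
def randomHardyNorm (q p : ℝ≥0∞) (F : Ω → ℂ → ℂ) (P : Measure Ω) : ℝ≥0∞ :=
  eLpNorm (fun ω => hardyNorm p (F ω)) q P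

/-- `F` belongs to `L^q(Ω, H^p)`: it is a random vector in `H^p` with `E ‖F‖_{H^p}^q < ∞`.
Measurability is that of the point evaluations; for `1 ≤ p < ∞` the space `H^p` is separable and
the evaluations generate its Borel sigma-algebra, so this is measurability as a map to `H^p`. -/
structure MemRandomHardy (q p : ℝ≥0∞) (F : Ω → ℂ → ℂ) (P : Measure Ω) : Prop where
  aemeasurable : ∀ z ∈ Metric.ball (0 : ℂ) 1, AEMeasurable (fun ω => F ω z) P
  mem_hardy : ∀ᵐ ω ∂P, MemHardy p (F ω)
  norm_lt_top : randomHardyNorm q p F P < ∞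

/-- The linear operator `R : H² → L^q(Ω, H^p)` is (well defined and) bounded. -/
def RandomizationBounded (X : ℕ → Ω → ℝ) (P : Measure Ω) (q p : ℝ≥0∞) : Prop :=
  (∀ f : ℂ → ℂ, MemHardy 2 f →
    (∀ᵐ ω ∂P, RandomizationMemHardy X p f ω) ∧ MemRandomHardy q p (randomization X f) P) ∧
  ∃ C : ℝ≥0, ∀ f : ℂ → ℂ, MemHardy 2 f →
    randomHardyNorm q p (randomization X f) P ≤ C * hardyNorm 2 f

/-- The covariance matrix of a real process. -/
def covMatrix (X : ℕ → Ω → ℝ) (P : Measure Ω) : Matrix ℕ ℕ ℝ :=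
  fun m n => cov[X m, X n; P]

end Randomization

/-- The infinite matrix `K` acts as a bounded linear operator on the complex space `ℓ²`. -/
def IsBoundedOnEllTwo (K : Matrix ℕ ℕ ℝ) : Prop :=
  ∃ T : lp (fun _ : ℕ => ℂ) 2 →L[ℂ] lp (fun _ : ℕ => ℂ) 2,
    ∀ (x : lp (fun _ : ℕ => ℂ) 2) (n : ℕ), HasSum (fun m => (K n m : ℂ) * x m) (T x n)

end

/-!
Write `a` for the Taylor coefficients of `f`, let `Y z = ∑ a n * X n * z ^ n`, and let
`σ z = ‖Y z‖_{L²(Ω)}`. The whole argument compares the random function `R f` with the deterministic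
function `σ`, through the quantities `circleDeviation`, the `L^p` norms of `σ` over circles.

The real and imaginary parts of `Y z` are centered Gaussian (`hasGaussianParts_randomSum`). Hence
every `L^s(Ω)` norm of `Y z` is at most a constant times `σ z` (`HasGaussianParts.eLpNorm_le`), and
`|Y z|` is rarely much smaller than `σ z` (`exists_measure_enorm_lt_le`).

*A bound `circleDeviation ≤ C ‖f‖` for all radii gives boundedness of `R`*
(`randomizationBounded_of_circleDeviation_le`). With `s = max p 2`, Minkowski's inequality for mixed
norms and the moment bound control the `L²(Ω)` norm of the `L^p` mean of `R f` over a circle by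
`circleDeviation`. Since these means increase with the radius (`eLpNorm_powerSum_circle_mono`),
monotone convergence moves the supremum over the radii inside the expectation.

*If the covariance matrix is bounded by `T` on `ℓ²`*, then `σ z ^ 2` is a value of its quadratic form,
so `σ z ^ 2 ≤ ‖T‖ ‖f‖ ^ 2` for every `z` in the disk, and the bound above is immediate.

*If `R f ∈ H^p` almost surely for each `f`*, choose `m` such that `‖R f‖ ≤ m` with probability at
least `1/2`. Integrating `|Y z| ^ p` over this event only, the small ball estimate shows that
`circleDeviation` is bounded over all radii, for each single `f`
(`HasLpProperty.exists_circleDeviation_le`). For a fixed radius, `circleDeviation` is a continuous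
seminorm on `ℓ²`, which is `H²` by Parseval's identity (`hardyNorm_two_sq_eq_tsum_taylorCoeff`); the
uniform boundedness principle makes the bound proportional to `‖f‖`
(`exists_circleDeviation_le_mul`). In this case, that `σ` is finite on the disk at all
follows from the convergence of `R f` for the single function `f = ∑ z ^ n / (n + 1)`
(`HasLpProperty.hasTemperedGrowth`).
-/

noncomputable section

open Filter Topology

/-! ### Power series on the unit disk -/

instance isProbabilityMeasure_arcMeasure : IsProbabilityMeasure arcMeasure := by
  constructor
  have h : (0 : ℝ) < 2 * Real.pi := by positivity
  rw [arcMeasure, Measure.smul_apply, Measure.restrict_apply MeasurableSet.univ, Set.univ_inter,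
    Real.volume_Ioc, sub_zero, smul_eq_mul, ← ENNReal.ofReal_mul (by positivity),
    inv_mul_cancel₀ h.ne', ENNReal.ofReal_one]

/-- The sum of the power series with coefficients `b`; it is `0` where the series diverges. -/
def powerSum (b : ℕ → ℂ) (z : ℂ) : ℂ := ∑' n, b n * z ^ n

/-- Absolute convergence of `∑ b n * z ^ n` throughout the open unit disk. -/
def ConvergesOnDisk (b : ℕ → ℂ) : Prop :=
  ∀ r : ℝ, 0 ≤ r → r < 1 → Summable fun n => ‖b n‖ * r ^ n

lemma convergesOnDisk_iff {b : ℕ → ℂ} :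
    ConvergesOnDisk b ↔ ∀ z ∈ Metric.ball (0 : ℂ) 1, Summable fun n => b n * z ^ n := by
  refine ⟨fun h z hz => ?_, fun h r h0 h1 => ?_⟩
  · refine Summable.of_norm ?_
    simpa using h ‖z‖ (norm_nonneg z) (by simpa using hz)
  · have := (h (r : ℂ) (by simpa [abs_of_nonneg h0] using h1)).norm
    simpa [abs_of_nonneg h0] using this

lemma ConvergesOnDisk.summable {b : ℕ → ℂ} (hb : ConvergesOnDisk b) {z : ℂ} (hz : ‖z‖ < 1) :
    Summable fun n => b n * z ^ n :=
  convergesOnDisk_iff.1 hb z (by simpa using hz)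

lemma convergesOnDisk_of_bounded {b : ℕ → ℂ} {C : ℝ} (hb : ∀ n, ‖b n‖ ≤ C) :
    ConvergesOnDisk b := fun r h0 h1 =>
  Summable.of_nonneg_of_le (fun n => by positivity)
    (fun n => mul_le_mul_of_nonneg_right (hb n) (by positivity))
    ((summable_geometric_of_lt_one h0 h1).mul_left C)

lemma differentiableOn_vectorPowerSeries {E : Type*} [NormedAddCommGroup E] [NormedSpace ℂ E]
    [CompleteSpace E] {b : ℕ → ℂ} (hb : ConvergesOnDisk b) {e : ℕ → E} (he : ∀ n, ‖e n‖ ≤ 1) :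
    DifferentiableOn ℂ (fun z : ℂ => ∑' n, (b n * z ^ n) • e n) (Metric.ball 0 1) := by
  intro z hz
  obtain ⟨r, hr1, hr2⟩ := exists_between (show ‖z‖ < 1 by simpa using hz)
  have hr0 : 0 ≤ r := (norm_nonneg z).trans hr1.le
  have : DifferentiableOn ℂ (fun z : ℂ => ∑' n, (b n * z ^ n) • e n) (Metric.ball 0 r) := by
    refine Complex.differentiableOn_tsum_of_summable_norm (hb r hr0 hr2) (fun n => ?_)
      Metric.isOpen_ball fun n w hw => ?_
    · exact Differentiable.differentiableOn (by fun_prop)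
    · rw [norm_smul, norm_mul, norm_pow]
      calc ‖b n‖ * ‖w‖ ^ n * ‖e n‖ ≤ ‖b n‖ * ‖w‖ ^ n * 1 := by gcongr; exact he n
        _ ≤ ‖b n‖ * r ^ n := by
          rw [mul_one]; gcongr; simpa using (Metric.mem_ball.1 hw).le
  exact ((this z (by simpa using hr1)).differentiableAt
    (Metric.isOpen_ball.mem_nhds (by simpa using hr1))).differentiableWithinAt

lemma differentiableOn_powerSum {b : ℕ → ℂ} (hb : ConvergesOnDisk b) :
    DifferentiableOn ℂ (powerSum b) (Metric.ball 0 1) := by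
  simpa [powerSum] using!
    differentiableOn_vectorPowerSeries hb (e := fun _ => (1 : ℂ)) (by simp)

lemma hasSum_taylorCoeff {f : ℂ → ℂ} (hf : DifferentiableOn ℂ f (Metric.ball 0 1)) {z : ℂ}
    (hz : z ∈ Metric.ball (0 : ℂ) 1) : HasSum (fun n => taylorCoeff f n * z ^ n) (f z) := by
  have h : (fun n => taylorCoeff f n * z ^ n) =
      fun n : ℕ => (n.factorial : ℂ)⁻¹ • (z - 0) ^ n • iteratedDeriv n f 0 := by
    ext n
    simp only [taylorCoeff, sub_zero, smul_eq_mul]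
    ring
  rw [h]
  exact Complex.hasSum_taylorSeries_on_ball hf hz

lemma convergesOnDisk_taylorCoeff {f : ℂ → ℂ} (hf : DifferentiableOn ℂ f (Metric.ball 0 1)) :
    ConvergesOnDisk (taylorCoeff f) :=
  convergesOnDisk_iff.2 fun _ hz => (hasSum_taylorCoeff hf hz).summable

lemma powerSum_taylorCoeff {f : ℂ → ℂ} (hf : DifferentiableOn ℂ f (Metric.ball 0 1)) {z : ℂ}
    (hz : z ∈ Metric.ball (0 : ℂ) 1) : powerSum (taylorCoeff f) z = f z :=
  (hasSum_taylorCoeff hf hz).tsum_eq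

lemma taylorCoeff_powerSum {b : ℕ → ℂ} (hb : ConvergesOnDisk b) :
    taylorCoeff (powerSum b) = b := by
  have h1 : HasFPowerSeriesOnBall (powerSum b) (FormalMultilinearSeries.ofScalars ℂ b) 0 1 := by
    refine ⟨?_, one_pos, fun {y} hy => ?_⟩
    · refine ENNReal.le_of_forall_nnreal_lt fun r hr => ?_
      refine FormalMultilinearSeries.le_radius_of_summable _ ?_
      have := hb r r.2 (by exact_mod_cast hr)
      refine this.congr fun n => ?_
      simp
    · have hy' : ‖y‖ < 1 := by
        have := hy
        simp only [Metric.mem_eball, edist_zero_right] at this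
        rw [← ofReal_norm, ← ENNReal.ofReal_one] at this
        exact (ENNReal.ofReal_lt_ofReal_iff one_pos).1 this
      simpa [FormalMultilinearSeries.ofScalars_apply_eq, mul_comm, powerSum] using
        (hb.summable hy').hasSum
  ext n
  have h2 := h1.factorial_smul 1 n
  rw [← iteratedDeriv_eq_iteratedFDeriv, FormalMultilinearSeries.ofScalars_apply_eq] at h2
  have h3 : ((n.factorial : ℕ) : ℂ) ≠ 0 := by exact_mod_cast n.factorial_ne_zero
  rw [taylorCoeff, ← h2]
  simp [h3]

/-! ### Circle means -/

/-- The character `θ ↦ exp (i n θ)`. -/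
def circleChar (n : ℕ) : BoundedContinuousFunction ℝ ℂ :=
  BoundedContinuousFunction.ofNormedAddCommGroup (fun θ => Complex.exp (θ * Complex.I) ^ n)
    (by fun_prop) 1 (by simp [Complex.norm_exp_ofReal_mul_I])

lemma circleChar_apply (n : ℕ) (θ : ℝ) : circleChar n θ = Complex.exp (θ * Complex.I) ^ n := rfl

lemma norm_circleChar_le (n : ℕ) : ‖circleChar n‖ ≤ 1 :=
  BoundedContinuousFunction.norm_ofNormedAddCommGroup_le _ zero_le_one _

/-- The function `θ ↦ g (z e^{iθ})`, where `g` is the sum of the power series with coefficients `b`. -/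
def rotatedSum (b : ℕ → ℂ) (z : ℂ) : BoundedContinuousFunction ℝ ℂ :=
  ∑' n, (b n * z ^ n) • circleChar n

lemma hasSum_rotatedSum {b : ℕ → ℂ} (hb : ConvergesOnDisk b) {z : ℂ} (hz : ‖z‖ < 1) :
    HasSum (fun n => (b n * z ^ n) • circleChar n) (rotatedSum b z) := by
  refine Summable.hasSum (Summable.of_norm_bounded (hb ‖z‖ (norm_nonneg z) hz) fun n => ?_)
  rw [norm_smul, norm_mul, norm_pow]
  exact mul_le_of_le_one_right (by positivity) (norm_circleChar_le n)

lemma rotatedSum_apply {b : ℕ → ℂ} (hb : ConvergesOnDisk b) {z : ℂ} (hz : ‖z‖ < 1) (θ : ℝ) :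
    rotatedSum b z θ = powerSum b (z * Complex.exp (θ * Complex.I)) := by
  have h := (hasSum_rotatedSum hb hz).mapL (BoundedContinuousFunction.evalCLM ℂ θ)
  rw [powerSum, ← BoundedContinuousFunction.evalCLM_apply ℂ θ (rotatedSum b z), ← h.tsum_eq]
  refine tsum_congr fun n => ?_
  simp [circleChar_apply, mul_pow, mul_assoc]

lemma eLpNorm_rotatedSum {b : ℕ → ℂ} (hb : ConvergesOnDisk b) {r : ℝ} (h0 : 0 ≤ r) (h1 : r < 1)
    (p : ℝ≥0∞) :
    eLpNorm (rotatedSum b r) p arcMeasure =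
      eLpNorm (fun θ : ℝ => powerSum b (circleMap 0 r θ)) p arcMeasure := by
  congr 1
  ext θ
  rw [rotatedSum_apply hb (by simpa [abs_of_nonneg h0] using h1), circleMap_zero]

lemma circleMap_zero_mul_exp (r α θ : ℝ) :
    circleMap 0 r α * Complex.exp (θ * Complex.I) = circleMap 0 r (θ + α) := by
  simp only [circleMap_zero, Complex.ofReal_add, add_mul, Complex.exp_add]
  ring

lemma lintegral_arcMeasure (g : ℝ → ℝ≥0∞) :
    ∫⁻ θ, g θ ∂arcMeasure =
      ENNReal.ofReal (2 * Real.pi)⁻¹ * ∫⁻ θ in Set.Ioc 0 (2 * Real.pi), g θ := by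
  rw [arcMeasure, lintegral_smul_measure, smul_eq_mul]

lemma lintegral_arcMeasure_translate {g : ℝ → ℝ≥0∞} (hg : Function.Periodic g (2 * Real.pi))
    (α : ℝ) : ∫⁻ θ, g (θ + α) ∂arcMeasure = ∫⁻ θ, g θ ∂arcMeasure := by
  rw [lintegral_arcMeasure, lintegral_arcMeasure]
  congr 1
  have hpi : (0 : ℝ) < 2 * Real.pi := by positivity
  have h1 := (isAddFundamentalDomain_Ioc hpi 0 : IsAddFundamentalDomain _ _ (volume : Measure ℝ))
  have h2 := (isAddFundamentalDomain_Ioc hpi α : IsAddFundamentalDomain _ _ (volume : Measure ℝ))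
  have h3 : ∫⁻ θ in Set.Ioc 0 (2 * Real.pi), g (θ + α) =
      ∫⁻ θ in Set.Ioc α (α + 2 * Real.pi), g θ := by
    have := (measurePreserving_add_right (volume : Measure ℝ) α).setLIntegral_comp_preimage_emb
      (measurableEmbedding_addRight α) g (Set.Ioc α (α + 2 * Real.pi))
    rw [← this]
    congr 2
    ext x; simp [add_comm]
  rw [h3]
  have h4 := h1.setLIntegral_eq h2 g (fun γ x => by
    obtain ⟨k, hk⟩ := AddSubgroup.mem_zmultiples_iff.1 γ.2
    have : g (k • (2 * Real.pi) + x) = g x := by rw [add_comm]; exact hg.zsmul k x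
    rw [← this, hk]; rfl)
  simpa using h4.symm

lemma eLpNorm_rotatedSum_circleMap {b : ℕ → ℂ} (hb : ConvergesOnDisk b) {r : ℝ} (h0 : 0 ≤ r)
    (h1 : r < 1) {p : ℝ≥0∞} (hp0 : p ≠ 0) (hp : p ≠ ∞) (α : ℝ) :
    eLpNorm (rotatedSum b (circleMap 0 r α)) p arcMeasure =
      eLpNorm (rotatedSum b r) p arcMeasure := by
  have hn : ‖circleMap 0 r α‖ < 1 := by simpa [abs_of_nonneg h0] using h1
  have hn' : ‖(r : ℂ)‖ < 1 := by simpa [abs_of_nonneg h0] using h1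
  rw [eLpNorm_eq_lintegral_rpow_enorm_toReal hp0 hp, eLpNorm_eq_lintegral_rpow_enorm_toReal hp0 hp]
  congr 1
  simp_rw [rotatedSum_apply hb hn, rotatedSum_apply hb hn', circleMap_zero_mul_exp]
  rw [lintegral_arcMeasure_translate (g := fun θ => ‖powerSum b (circleMap 0 r θ)‖ₑ ^ p.toReal)]
  · simp [circleMap_zero]
  · intro θ
    simp only [periodic_circleMap 0 r θ]

/-- The circle means of a holomorphic function increase with the radius. The maximum modulus
principle for the `L^p`-valued holomorphic function `z ↦ g (z e^{i ·})` gives this for every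
`p ≥ 1`: the `L^p` norm of its value at `z` depends only on `|z|`. -/
lemma eLpNorm_powerSum_circle_mono {b : ℕ → ℂ} (hb : ConvergesOnDisk b) {r R : ℝ} (h0 : 0 ≤ r)
    (hrR : r ≤ R) (hR : R < 1) {p : ℝ≥0∞} (hp1 : 1 ≤ p) (hp : p ≠ ∞) :
    eLpNorm (fun θ : ℝ => powerSum b (circleMap 0 r θ)) p arcMeasure ≤
      eLpNorm (fun θ : ℝ => powerSum b (circleMap 0 R θ)) p arcMeasure := by
  have : Fact (1 ≤ p) := ⟨hp1⟩
  have hp0 : p ≠ 0 := (zero_lt_one.trans_le hp1).ne'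
  have hR0 : 0 ≤ R := h0.trans hrR
  rcases hR0.eq_or_lt with rfl | hRpos
  · rw [le_antisymm hrR h0]
  rw [← eLpNorm_rotatedSum hb h0 (hrR.trans_lt hR), ← eLpNorm_rotatedSum hb hR0 hR]
  let T := BoundedContinuousFunction.toLp (E := ℂ) p arcMeasure ℂ
  have hT : ∀ g : BoundedContinuousFunction ℝ ℂ, eLpNorm g p arcMeasure = ‖T g‖ₑ := fun g => by
    rw [Lp.enorm_def]
    exact eLpNorm_congr_ae (BoundedContinuousFunction.coeFn_toLp p arcMeasure ℂ g).symm
  have hd : DifferentiableOn ℂ (fun z => T (rotatedSum b z)) (Metric.ball 0 1) :=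
    T.differentiable.comp_differentiableOn
      (differentiableOn_vectorPowerSeries hb norm_circleChar_le)
  have key : ‖T (rotatedSum b r)‖ ≤ ‖T (rotatedSum b R)‖ := by
    refine Complex.norm_le_of_forall_mem_frontier_norm_le (U := Metric.ball 0 R)
      (f := fun z => T (rotatedSum b z)) Metric.isBounded_ball ?_ ?_ ?_
    · refine DifferentiableOn.diffContOnCl (hd.mono ?_)
      rw [closure_ball _ hRpos.ne']
      exact Metric.closedBall_subset_ball hR
    · intro z hz
      rw [frontier_ball _ hRpos.ne'] at hz
      obtain ⟨α, rfl⟩ : ∃ α, circleMap 0 R α = z := by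
        rw [← abs_of_nonneg hR0, ← range_circleMap] at hz
        exact hz
      have := eLpNorm_rotatedSum_circleMap hb hR0 hR hp0 hp α
      rw [hT, hT] at this
      rw [← toReal_enorm, ← toReal_enorm, this]
    · rw [closure_ball _ hRpos.ne']
      simpa [abs_of_nonneg h0] using hrR
  rw [hT, hT, ← ofReal_norm, ← ofReal_norm]
  exact ENNReal.ofReal_le_ofReal key

/-! ### Parseval's identity -/

lemma integral_circleChar (m n : ℕ) :
    ∫ θ, circleChar n θ * starRingEnd ℂ (circleChar m θ) ∂arcMeasure = if m = n then 1 else 0 := by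
  have hpi : (0 : ℝ) < 2 * Real.pi := by positivity
  have h1 : ∀ θ : ℝ, circleChar n θ * starRingEnd ℂ (circleChar m θ) =
      Complex.exp ((((n : ℂ) - m) * Complex.I) * θ) := fun θ => by
    rw [circleChar_apply, circleChar_apply, map_pow, ← Complex.exp_conj, ← Complex.exp_nat_mul,
      ← Complex.exp_nat_mul, ← Complex.exp_add]
    simp only [map_mul, Complex.conj_ofReal, Complex.conj_I]
    ring_nf
  simp_rw [h1]
  split_ifs with h
  · simp [h]
  · rw [arcMeasure, integral_smul_measure, ← intervalIntegral.integral_of_le hpi.le,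
      integral_exp_mul_complex]
    · have : ((n : ℂ) - m) * Complex.I * ((2 * Real.pi : ℝ) : ℂ) =
          ((n - m : ℤ) : ℂ) * (2 * Real.pi * Complex.I) := by push_cast; ring
      rw [this, Complex.exp_int_mul_two_pi_mul_I]
      simp
    · refine mul_ne_zero (sub_ne_zero.2 ?_) Complex.I_ne_zero
      exact_mod_cast Ne.symm h

/-- Parseval's identity on the circle of radius `r`. -/
lemma eLpNorm_two_powerSum_sq {b : ℕ → ℂ} (hb : ConvergesOnDisk b) {r : ℝ} (h0 : 0 ≤ r)
    (h1 : r < 1) :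
    eLpNorm (fun θ : ℝ => powerSum b (circleMap 0 r θ)) 2 arcMeasure ^ 2 =
      ∑' n, ‖b n * (r : ℂ) ^ n‖ₑ ^ 2 := by
  have hr : ‖(r : ℂ)‖ < 1 := by simpa [abs_of_nonneg h0] using h1
  let T := BoundedContinuousFunction.toLp (E := ℂ) 2 arcMeasure ℂ
  let e : ℕ → Lp ℂ 2 arcMeasure := fun n => T (circleChar n)
  have he : ∀ m n, inner ℂ (e m) (e n) = if m = n then (1 : ℂ) else 0 := fun m n => by
    rw [L2.inner_def, ← integral_circleChar]
    refine integral_congr_ae ?_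
    filter_upwards [BoundedContinuousFunction.coeFn_toLp 2 arcMeasure ℂ (circleChar m),
      BoundedContinuousFunction.coeFn_toLp 2 arcMeasure ℂ (circleChar n)] with θ h1 h2
    simp only [e, T]
    rw [h1, h2]
    rfl
  have hs : HasSum (fun n => (b n * (r : ℂ) ^ n) • e n) (T (rotatedSum b r)) := by
    simpa [e] using (hasSum_rotatedSum hb hr).mapL T
  have hc : ∀ m, inner ℂ (e m) (T (rotatedSum b r)) = b m * (r : ℂ) ^ m := fun m => by
    have := hs.mapL (innerSL ℂ (e m))
    simp only [innerSL_apply_apply, inner_smul_right, he] at this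
    rw [← this.tsum_eq]
    simp
  have hn : HasSum (fun n => ‖b n * (r : ℂ) ^ n‖ ^ 2) (‖T (rotatedSum b r)‖ ^ 2) := by
    have := hs.mapL (innerSL ℂ (T (rotatedSum b r)))
    simp only [innerSL_apply_apply, inner_smul_right] at this
    rw [inner_self_eq_norm_sq_to_K] at this
    have h3 : ∀ n, (b n * (r : ℂ) ^ n) * inner ℂ (T (rotatedSum b r)) (e n) =
        ((‖b n * (r : ℂ) ^ n‖ ^ 2 : ℝ) : ℂ) := fun n => by
      rw [← inner_conj_symm, hc, Complex.mul_conj, Complex.normSq_eq_norm_sq]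
    simp_rw [h3] at this
    exact Complex.hasSum_ofReal.1 (by simpa only [Complex.ofReal_pow] using! this)
  have hE : eLpNorm (fun θ : ℝ => powerSum b (circleMap 0 r θ)) 2 arcMeasure =
      ENNReal.ofReal ‖T (rotatedSum b r)‖ := by
    rw [← eLpNorm_rotatedSum hb h0 h1, ofReal_norm, Lp.enorm_def]
    exact eLpNorm_congr_ae
      (BoundedContinuousFunction.coeFn_toLp 2 arcMeasure ℂ (rotatedSum b r)).symm
  rw [hE, ← ENNReal.ofReal_pow (norm_nonneg _), ← hn.tsum_eq,
    ENNReal.ofReal_tsum_of_nonneg (fun n => by positivity) hn.summable]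
  simp_rw [ENNReal.ofReal_pow (norm_nonneg _), ofReal_norm]

/-- The Hardy norm in `H²` is the `ℓ²` norm of the coefficients. -/
lemma hardyNorm_two_sq {b : ℕ → ℂ} (hb : ConvergesOnDisk b) :
    hardyNorm 2 (powerSum b) ^ 2 = ∑' n, ‖b n‖ₑ ^ 2 := by
  have h : hardyNorm 2 (powerSum b) ^ 2 =
      ⨆ r ∈ Set.Ioo (0 : ℝ) 1, ∑' n, ‖b n * (r : ℂ) ^ n‖ₑ ^ 2 := by
    rw [hardyNorm, ENNReal.iSup_pow_of_ne_zero two_ne_zero]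
    refine iSup_congr fun r => ?_
    rw [ENNReal.iSup_pow_of_ne_zero two_ne_zero]
    exact iSup_congr fun hr => eLpNorm_two_powerSum_sq hb hr.1.le hr.2
  rw [h]
  apply le_antisymm
  · refine iSup₂_le fun r hr => ENNReal.tsum_le_tsum fun n => ?_
    gcongr
    rw [enorm_mul]
    refine mul_le_of_le_one_right' ?_
    rw [← ofReal_norm, ← ENNReal.ofReal_one]
    refine ENNReal.ofReal_le_ofReal ?_
    rw [norm_pow, Complex.norm_real, Real.norm_eq_abs, abs_of_nonneg hr.1.le]
    exact pow_le_one₀ hr.1.le hr.2.le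
  · rw [ENNReal.tsum_eq_iSup_sum]
    refine iSup_le fun s => ?_
    have hc : Continuous fun r : ℝ => ∑ n ∈ s, ‖b n * (r : ℂ) ^ n‖ₑ ^ 2 :=
      continuous_finsetSum _ fun n _ => (ENNReal.continuous_pow 2).comp (by fun_prop)
    have ht : Tendsto (fun r : ℝ => ∑ n ∈ s, ‖b n * (r : ℂ) ^ n‖ₑ ^ 2) (𝓝[<] 1)
        (𝓝 (∑ n ∈ s, ‖b n‖ₑ ^ 2)) := by
      simpa using (hc.tendsto 1).mono_left nhdsWithin_le_nhds
    refine le_of_tendsto ht ?_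
    filter_upwards [Ioo_mem_nhdsLT (zero_lt_one' ℝ)] with r hr
    exact le_iSup₂_of_le r hr (ENNReal.sum_le_tsum s)

lemma circleMap_zero_mem_ball {r : ℝ} (h0 : 0 ≤ r) (h1 : r < 1) (θ : ℝ) :
    circleMap 0 r θ ∈ Metric.ball (0 : ℂ) 1 := by
  simpa [abs_of_nonneg h0] using h1

lemma hardyNorm_congr {p : ℝ≥0∞} {f g : ℂ → ℂ} (h : Set.EqOn f g (Metric.ball 0 1)) :
    hardyNorm p f = hardyNorm p g := by
  refine iSup_congr fun r => iSup_congr fun hr => ?_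
  congr 1
  ext θ
  exact h (circleMap_zero_mem_ball hr.1.le hr.2 θ)

lemma hardyNorm_two_sq_eq_tsum_taylorCoeff {f : ℂ → ℂ}
    (hf : DifferentiableOn ℂ f (Metric.ball 0 1)) :
    hardyNorm 2 f ^ 2 = ∑' n, ‖taylorCoeff f n‖ₑ ^ 2 := by
  rw [← hardyNorm_two_sq (convergesOnDisk_taylorCoeff hf)]
  congr 1
  exact hardyNorm_congr fun z hz => (powerSum_taylorCoeff hf hz).symm

lemma memHardy_two_powerSum {b : ℕ → ℂ} (hb : ∑' n, ‖b n‖ₑ ^ 2 ≠ ∞) :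
    ConvergesOnDisk b ∧ MemHardy 2 (powerSum b) := by
  have h1 : ConvergesOnDisk b := by
    refine convergesOnDisk_of_bounded (C := (∑' n, ‖b n‖ₑ ^ 2).toReal + 1) fun n => ?_
    have h2 : ‖b n‖ ^ 2 ≤ (∑' n, ‖b n‖ₑ ^ 2).toReal := by
      have := ENNReal.toReal_mono hb (ENNReal.le_tsum (f := fun n => ‖b n‖ₑ ^ 2) n)
      simpa using this
    nlinarith [norm_nonneg (b n), sq_nonneg (‖b n‖ - 1)]
  refine ⟨h1, differentiableOn_powerSum h1, ?_⟩
  have := hardyNorm_two_sq h1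
  rw [lt_top_iff_ne_top]
  intro h
  rw [h] at this
  exact hb (by simpa using this.symm)

/-! ### Exhaustion of the disk -/

/-- Radii increasing to `1`. They start at `1 / 2`, so that all of them lie in `(0, 1)`. -/
def radius (k : ℕ) : ℝ := 1 - 1 / ((k : ℝ) + 2)

lemma radius_mem (k : ℕ) : radius k ∈ Set.Ioo (0 : ℝ) 1 := by
  have h : (0 : ℝ) < (k : ℝ) + 2 := by positivity
  have h2 : 1 / ((k : ℝ) + 2) < 1 := by rw [div_lt_one h]; linarith
  have h3 : 0 < 1 / ((k : ℝ) + 2) := by positivity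
  constructor <;> simp only [radius] <;> linarith

lemma radius_mono : Monotone radius := fun j k h => by
  have : (j : ℝ) ≤ k := by exact_mod_cast h
  simp only [radius]
  gcongr

lemma exists_le_radius {r : ℝ} (hr : r < 1) : ∃ k, r ≤ radius k := by
  obtain ⟨k, hk⟩ := exists_nat_one_div_lt (sub_pos.2 hr)
  refine ⟨k, ?_⟩
  have : 1 / ((k : ℝ) + 2) ≤ 1 / ((k : ℝ) + 1) := by gcongr; norm_num
  simp only [radius]
  linarith

lemma hardyNorm_powerSum_eq_iSup {b : ℕ → ℂ} (hb : ConvergesOnDisk b) {p : ℝ≥0∞} (hp1 : 1 ≤ p)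
    (hp : p ≠ ∞) :
    hardyNorm p (powerSum b) =
      ⨆ k, eLpNorm (fun θ : ℝ => powerSum b (circleMap 0 (radius k) θ)) p arcMeasure := by
  apply le_antisymm
  · refine iSup₂_le fun r hr => ?_
    obtain ⟨k, hk⟩ := exists_le_radius hr.2
    exact le_iSup_of_le k (eLpNorm_powerSum_circle_mono hb hr.1.le hk (radius_mem k).2 hp1 hp)
  · exact iSup_le fun k => le_iSup₂_of_le (radius k) (radius_mem k) le_rfl

/-! ### Moments and small balls of Gaussian variables -/

/-- The `L^s` norm of the standard Gaussian distribution. -/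
def gaussianMoment (s : ℝ≥0∞) : ℝ≥0∞ := eLpNorm id s (gaussianReal 0 1)

lemma gaussianMoment_ne_top {s : ℝ≥0∞} (hs : s ≠ ∞) : gaussianMoment s ≠ ∞ :=
  (memLp_id_gaussianReal' s hs).eLpNorm_ne_top

lemma gaussianMoment_two_ne_zero : gaussianMoment 2 ≠ 0 := by
  intro h
  have h1 := (eLpNorm_eq_zero_iff aestronglyMeasurable_id two_ne_zero).1 h
  have h2 := variance_congr h1
  rw [variance_id_gaussianReal, variance_zero] at h2
  exact one_ne_zero h2

lemma gaussianReal_eq_map_sqrt (v : ℝ≥0) :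
    gaussianReal 0 v = (gaussianReal 0 1).map (fun x => √(v : ℝ) * x) := by
  rw [gaussianReal_map_const_mul]
  congr 1
  · simp
  · ext; simp

section

variable {Ω : Type*} [MeasurableSpace Ω] {P : Measure Ω}

lemma eLpNorm_of_map_eq_gaussianReal {U : Ω → ℝ} {v : ℝ≥0} (hU : AEMeasurable U P)
    (h : P.map U = gaussianReal 0 v) (s : ℝ≥0∞) :
    eLpNorm U s P = ‖√(v : ℝ)‖ₑ * gaussianMoment s := by
  have h1 : eLpNorm U s P = eLpNorm id s (P.map U) :=
    (eLpNorm_map_measure aestronglyMeasurable_id hU).symm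
  rw [h1, h, gaussianReal_eq_map_sqrt,
    eLpNorm_map_measure aestronglyMeasurable_id (by fun_prop), gaussianMoment]
  exact eLpNorm_const_smul (√(v : ℝ)) id s (gaussianReal 0 1)

lemma exists_gaussianReal_ball_le : ∃ ε : ℝ≥0, 0 < ε ∧
    gaussianReal 0 1 {x : ℝ | ‖x‖ₑ < ε} ≤ 1 / 8 := by
  have h0 : gaussianReal 0 1 {(0 : ℝ)} = 0 := by
    have := nullSingletonClass_gaussianReal (μ := 0) (v := 1) one_ne_zero
    exact measure_singleton _
  have h1 := tendsto_measure_cthickening_of_isClosed (μ := gaussianReal 0 1) (s := {(0 : ℝ)})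
    ⟨1, one_pos, measure_ne_top _ _⟩ isClosed_singleton
  rw [h0] at h1
  have h2 := h1.eventually (ge_mem_nhds (show (0 : ℝ≥0∞) < 1 / 8 by simp))
  obtain ⟨ε, h3, hε⟩ := ((h2.filter_mono (nhdsWithin_le_nhds (s := Set.Ioi 0))).and
    self_mem_nhdsWithin).exists
  refine ⟨⟨ε, (Set.mem_Ioi.1 hε).le⟩, hε, (measure_mono fun x hx => ?_).trans h3⟩
  rw [Metric.cthickening_singleton _ (Set.mem_Ioi.1 hε).le]
  have hx' : ‖x‖ₑ < ENNReal.ofReal ε := by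
    rwa [ENNReal.ofReal_eq_coe_nnreal (Set.mem_Ioi.1 hε).le]
  rw [← ofReal_norm] at hx'
  simpa using (ENNReal.ofReal_lt_ofReal_iff (Set.mem_Ioi.1 hε)).1 hx' |>.le

/-- Scaling makes the small ball estimate uniform in the variance, the case `v = 0` included. -/
lemma measure_enorm_lt_of_map_eq_gaussianReal {U : Ω → ℝ} {v : ℝ≥0} (hU : AEMeasurable U P)
    (h : P.map U = gaussianReal 0 v) {ε : ℝ≥0}
    (hε : gaussianReal 0 1 {x : ℝ | ‖x‖ₑ < ε} ≤ 1 / 8) :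
    P {ω | ‖U ω‖ₑ < ε * ‖√(v : ℝ)‖ₑ} ≤ 1 / 8 := by
  have h1 : P {ω | ‖U ω‖ₑ < ε * ‖√(v : ℝ)‖ₑ} = P.map U {x | ‖x‖ₑ < ε * ‖√(v : ℝ)‖ₑ} := by
    rw [Measure.map_apply_of_aemeasurable hU]
    · rfl
    · exact measurableSet_lt measurable_enorm measurable_const
  rw [h1, h, gaussianReal_eq_map_sqrt, Measure.map_apply (by fun_prop)
    (measurableSet_lt measurable_enorm measurable_const)]
  refine (measure_mono fun x hx => ?_).trans hε
  simp only [Set.mem_preimage, Set.mem_ofPred_eq, enorm_mul] at hx ⊢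
  rw [mul_comm] at hx
  exact lt_of_mul_lt_mul_right' hx

/-- A complex random variable whose real and imaginary parts are centered Gaussian, possibly
degenerate and possibly dependent. -/
structure HasGaussianParts (Y : Ω → ℂ) (P : Measure Ω) : Prop where
  aemeasurable : AEMeasurable Y P
  re : ∃ v, P.map (fun ω => (Y ω).re) = gaussianReal 0 v
  im : ∃ v, P.map (fun ω => (Y ω).im) = gaussianReal 0 v

lemma eLpNorm_le_re_add_im {Y : Ω → ℂ} (hY : AEMeasurable Y P) {s : ℝ≥0∞} (hs : 1 ≤ s) :
    eLpNorm Y s P ≤ eLpNorm (fun ω => (Y ω).re) s P + eLpNorm (fun ω => (Y ω).im) s P := by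
  have h1 : AEStronglyMeasurable (fun ω => ((Y ω).re : ℂ)) P :=
    (Complex.measurable_ofReal.comp_aemeasurable
      (Complex.measurable_re.comp_aemeasurable hY)).aestronglyMeasurable
  have h2 : AEStronglyMeasurable (fun ω => ((Y ω).im : ℂ) * Complex.I) P :=
    ((Complex.measurable_ofReal.comp_aemeasurable
      (Complex.measurable_im.comp_aemeasurable hY)).mul_const _).aestronglyMeasurable
  calc eLpNorm Y s P = eLpNorm ((fun ω => ((Y ω).re : ℂ)) + fun ω => ((Y ω).im : ℂ) * Complex.I) s P := by
        congr 1; ext ω; simp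
    _ ≤ _ := eLpNorm_add_le h1 h2 hs
    _ = _ := by
        congr 1
        · exact eLpNorm_congr_norm_ae (by simp)
        · exact eLpNorm_congr_norm_ae (by simp)

/-- All moments of a complex Gaussian variable are controlled by its second moment. -/
lemma HasGaussianParts.eLpNorm_le {Y : Ω → ℂ} (hY : HasGaussianParts Y P) {s : ℝ≥0∞} (hs : 1 ≤ s) :
    eLpNorm Y s P ≤ 2 * gaussianMoment s / gaussianMoment 2 * eLpNorm Y 2 P := by
  obtain ⟨u, hu⟩ := hY.re
  obtain ⟨v, hv⟩ := hY.im
  have hre : AEMeasurable (fun ω => (Y ω).re) P :=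
    Complex.measurable_re.comp_aemeasurable hY.aemeasurable
  have him : AEMeasurable (fun ω => (Y ω).im) P :=
    Complex.measurable_im.comp_aemeasurable hY.aemeasurable
  have h2 := gaussianMoment_two_ne_zero
  have h2' := gaussianMoment_ne_top (s := 2) (by simp)
  have key : ∀ {U : Ω → ℝ} {v : ℝ≥0}, AEMeasurable U P → P.map U = gaussianReal 0 v →
      (∀ ω, ‖U ω‖ ≤ ‖Y ω‖) →
      eLpNorm U s P ≤ gaussianMoment s / gaussianMoment 2 * eLpNorm Y 2 P := by
    intro U v hU hv hle
    calc eLpNorm U s P = gaussianMoment s / gaussianMoment 2 * eLpNorm U 2 P := by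
          rw [eLpNorm_of_map_eq_gaussianReal hU hv, eLpNorm_of_map_eq_gaussianReal hU hv,
            mul_left_comm, ENNReal.div_mul_cancel h2 h2']
      _ ≤ _ := by gcongr; exact eLpNorm_mono hle
  calc eLpNorm Y s P ≤ _ := eLpNorm_le_re_add_im hY.aemeasurable hs
    _ ≤ _ := add_le_add (key hre hu fun ω => Complex.abs_re_le_norm _)
        (key him hv fun ω => Complex.abs_im_le_norm _)
    _ = _ := by rw [← two_mul, ← mul_assoc, ← mul_div_assoc]

/-- Small ball estimate: with one `ε` for all complex Gaussian variables, `Y` has absolute value below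
`ε` times its `L²` norm with probability at most `1 / 8`. The inequality is strict, so the event is
empty if `Y = 0` almost surely. -/
lemma exists_measure_enorm_lt_le (P : Measure Ω) : ∃ ε : ℝ≥0∞, ε ≠ 0 ∧ ε ≠ ∞ ∧
    ∀ Y : Ω → ℂ, HasGaussianParts Y P → P {ω | ‖Y ω‖ₑ < ε * eLpNorm Y 2 P} ≤ 1 / 8 := by
  obtain ⟨ε, hε0, hε⟩ := exists_gaussianReal_ball_le
  have h2 := gaussianMoment_two_ne_zero
  have h2' := gaussianMoment_ne_top (s := 2) (by simp)
  have h22 : 2 * gaussianMoment 2 ≠ 0 := by simp [h2]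
  have h22' : 2 * gaussianMoment 2 ≠ ∞ := ENNReal.mul_ne_top (by simp) h2'
  refine ⟨ε / (2 * gaussianMoment 2), ENNReal.div_ne_zero.2 ⟨by simpa using hε0.ne', h22'⟩,
    ENNReal.div_ne_top (by simp) h22, fun Y hY => ?_⟩
  obtain ⟨u, hu⟩ := hY.re
  obtain ⟨v, hv⟩ := hY.im
  have hre : AEMeasurable (fun ω => (Y ω).re) P :=
    Complex.measurable_re.comp_aemeasurable hY.aemeasurable
  have him : AEMeasurable (fun ω => (Y ω).im) P :=
    Complex.measurable_im.comp_aemeasurable hY.aemeasurable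
  have hle := eLpNorm_le_re_add_im hY.aemeasurable (s := 2) (by simp)
  rw [eLpNorm_of_map_eq_gaussianReal hre hu, eLpNorm_of_map_eq_gaussianReal him hv] at hle
  -- The larger of the two parts carries at least half of the `L²` norm.
  have key : ∀ {U : Ω → ℝ} {w : ℝ≥0}, AEMeasurable U P → P.map U = gaussianReal 0 w →
      (∀ ω, ‖U ω‖ ≤ ‖Y ω‖) → ‖√(u : ℝ)‖ₑ ≤ ‖√(w : ℝ)‖ₑ → ‖√(v : ℝ)‖ₑ ≤ ‖√(w : ℝ)‖ₑ →
      P {ω | ‖Y ω‖ₑ < ε / (2 * gaussianMoment 2) * eLpNorm Y 2 P} ≤ 1 / 8 := by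
    intro U w hU hw hUY h1 h2
    refine (measure_mono fun ω hω => ?_).trans (measure_enorm_lt_of_map_eq_gaussianReal hU hw hε)
    refine (enorm_le_iff_norm_le.2 (hUY ω)).trans_lt (lt_of_lt_of_le hω ?_)
    calc ε / (2 * gaussianMoment 2) * eLpNorm Y 2 P
        ≤ ε / (2 * gaussianMoment 2) *
          (‖√(w : ℝ)‖ₑ * gaussianMoment 2 + ‖√(w : ℝ)‖ₑ * gaussianMoment 2) := by
          gcongr
          exact hle.trans (by gcongr)
      _ = ε / (2 * gaussianMoment 2) * (2 * gaussianMoment 2) * ‖√(w : ℝ)‖ₑ := by ring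
      _ = ε * ‖√(w : ℝ)‖ₑ := by rw [ENNReal.div_mul_cancel h22 h22']
  rcases le_total ‖√(u : ℝ)‖ₑ ‖√(v : ℝ)‖ₑ with h | h
  · exact key him hv (fun ω => Complex.abs_im_le_norm _) h le_rfl
  · exact key hre hu (fun ω => Complex.abs_re_le_norm _) le_rfl h

/-! ### Random series -/

/-- The countable triangle inequality in `L²`, for the series of absolute values. -/
lemma eLpNorm_two_tsum_enorm_le {f : ℕ → Ω → ℂ} (hf : ∀ n, AEMeasurable (f n) P) :
    eLpNorm (fun ω => ∑' n, ‖f n ω‖ₑ) 2 P ≤ ∑' n, eLpNorm (f n) 2 P := by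
  have hm : ∀ n, AEMeasurable (fun ω => ‖f n ω‖ₑ) P := fun n => (hf n).enorm
  have h1 : ∀ N, ∫⁻ ω, (∑ n ∈ Finset.range N, ‖f n ω‖ₑ) ^ 2 ∂P ≤
      (∑' n, eLpNorm (f n) 2 P) ^ 2 := fun N => by
    have h2 : eLpNorm (fun ω => ∑ n ∈ Finset.range N, ‖f n ω‖ₑ) 2 P ≤
        ∑' n, eLpNorm (f n) 2 P := by
      have := eLpNorm_sum_le (μ := P) (p := 2) (s := Finset.range N) (f := fun n ω => ‖f n ω‖ₑ)
        (fun n _ => (hm n).aestronglyMeasurable) (by simp)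
      simp only [eLpNorm_enorm] at this
      refine le_trans (le_of_eq ?_) (this.trans (ENNReal.sum_le_tsum _))
      congr 1
      ext ω; simp
    rw [eLpNorm_eq_lintegral_rpow_enorm_toReal two_ne_zero (by simp)] at h2
    have h3 := pow_le_pow_left' h2 2
    rw [← ENNReal.rpow_natCast, ← ENNReal.rpow_mul] at h3
    simpa using h3
  rw [eLpNorm_eq_lintegral_rpow_enorm_toReal two_ne_zero (by simp)]
  rw [show (1 / (2 : ℝ≥0∞).toReal) = ((2 : ℕ) : ℝ)⁻¹ by simp, ENNReal.rpow_inv_le_iff (by simp),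
    ENNReal.rpow_natCast]
  have h4 : ∀ ω, ‖∑' n, ‖f n ω‖ₑ‖ₑ ^ (2 : ℝ≥0∞).toReal =
      ⨆ N, (∑ n ∈ Finset.range N, ‖f n ω‖ₑ) ^ 2 := fun ω => by
    rw [← ENNReal.iSup_pow, ← ENNReal.tsum_eq_iSup_nat]
    simp
  simp_rw [h4]
  rw [lintegral_iSup']
  · exact iSup_le h1
  · exact fun N => (Finset.aemeasurable_fun_sum _ fun n _ => hm n).pow_const 2
  · refine ae_of_all _ fun ω => fun M N h => ?_
    dsimp only
    gcongr

lemma ae_tsum_enorm_lt_top {f : ℕ → Ω → ℂ} (hf : ∀ n, AEMeasurable (f n) P)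
    (h : ∑' n, eLpNorm (f n) 2 P ≠ ∞) : ∀ᵐ ω ∂P, ∑' n, ‖f n ω‖ₑ < ∞ := by
  have h1 := (eLpNorm_two_tsum_enorm_le hf).trans_lt h.lt_top
  rw [eLpNorm_lt_top_iff_lintegral_rpow_enorm_lt_top two_ne_zero (by simp)] at h1
  have h2 : AEMeasurable (fun ω => ‖∑' n, ‖f n ω‖ₑ‖ₑ ^ (2 : ℝ≥0∞).toReal) P :=
    ((AEMeasurable.tsum fun n => (hf n).enorm).enorm).pow_const _
  filter_upwards [ae_lt_top' h2 h1.ne] with ω hω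
  simpa using hω

lemma integral_sq_of_map_eq_gaussianReal {U : Ω → ℝ} {v : ℝ≥0} (hU : AEMeasurable U P)
    (h : P.map U = gaussianReal 0 v) : ∫ ω, U ω ^ 2 ∂P = v := by
  have h1 : ∫ ω, U ω ^ 2 ∂P = ∫ x, x ^ 2 ∂(P.map U) :=
    (integral_map hU (f := fun x : ℝ => x ^ 2) (by fun_prop)).symm
  rw [h1, h, ← variance_id_gaussianReal (μ := 0) (v := v),
    variance_of_integral_eq_zero aemeasurable_id (by simp)]
  rfl

/-- A dominated almost sure limit of centered Gaussian variables is centered Gaussian. -/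
lemma exists_map_eq_gaussianReal_of_tendsto [IsProbabilityMeasure P] {U : ℕ → Ω → ℝ} {V : Ω → ℝ}
    {W : Ω → ℝ} (hU : ∀ N, AEMeasurable (U N) P)
    (hlaw : ∀ N, ∃ v, P.map (U N) = gaussianReal 0 v)
    (hW : Integrable (fun ω => W ω ^ 2) P) (hUW : ∀ N, ∀ᵐ ω ∂P, |U N ω| ≤ W ω)
    (hlim : ∀ᵐ ω ∂P, Tendsto (fun N => U N ω) atTop (𝓝 (V ω))) :
    ∃ v, P.map V = gaussianReal 0 v := by
  have hV : AEMeasurable V P := aemeasurable_of_tendsto_metrizable_ae _ hU hlim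
  choose v hv using hlaw
  -- The variances converge by dominated convergence; so do the characteristic functions.
  have hvar : Tendsto (fun N => ((v N : ℝ))) atTop (𝓝 (∫ ω, V ω ^ 2 ∂P)) := by
    simp_rw [← fun N => integral_sq_of_map_eq_gaussianReal (hU N) (hv N)]
    refine tendsto_integral_of_dominated_convergence (fun ω => W ω ^ 2)
      (fun N => ((hU N).pow_const 2).aestronglyMeasurable) hW (fun N => ?_) ?_
    · filter_upwards [hUW N] with ω hω
      rw [norm_pow, Real.norm_eq_abs]
      gcongr
    · filter_upwards [hlim] with ω hω using hω.pow 2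
  have hnn : 0 ≤ ∫ ω, V ω ^ 2 ∂P := integral_nonneg fun ω => sq_nonneg _
  refine ⟨(∫ ω, V ω ^ 2 ∂P).toNNReal, ?_⟩
  have := Measure.isProbabilityMeasure_map (μ := P) hV
  refine Measure.ext_of_charFun (funext fun t => ?_)
  have h1 : ∀ {Z : Ω → ℝ}, AEMeasurable Z P →
      charFun (P.map Z) t = ∫ ω, Complex.exp (t * Z ω * Complex.I) ∂P := fun hZ => by
    rw [charFun_apply_real, integral_map hZ (by fun_prop)]
  have h2 : Tendsto (fun N => charFun (P.map (U N)) t) atTop (𝓝 (charFun (P.map V) t)) := by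
    rw [h1 hV]
    simp_rw [fun N => h1 (hU N)]
    refine tendsto_integral_of_dominated_convergence (fun _ => 1) (fun N => ?_)
      (integrable_const 1) (fun N => ae_of_all _ fun ω => ?_) ?_
    · exact (AEMeasurable.cexp (((Complex.measurable_ofReal.comp_aemeasurable (hU N)).const_mul
        _).mul_const _)).aestronglyMeasurable
    · rw [← Complex.ofReal_mul, Complex.norm_exp_ofReal_mul_I]
    · filter_upwards [hlim] with ω hω
      exact ((Complex.continuous_exp.comp (by fun_prop : Continuous fun x : ℝ =>
        (t * x * Complex.I : ℂ))).tendsto _).comp hω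
  have h3 : Tendsto (fun N => charFun (P.map (U N)) t) atTop
      (𝓝 (charFun (gaussianReal 0 (∫ ω, V ω ^ 2 ∂P).toNNReal) t)) := by
    simp_rw [hv, charFun_gaussianReal, Real.coe_toNNReal _ hnn]
    refine (Complex.continuous_exp.tendsto _).comp (tendsto_const_nhds.sub ?_)
    exact (((Complex.continuous_ofReal.tendsto _).comp hvar).mul_const _).div_const _
  exact tendsto_nhds_unique h2 h3

variable {X : ℕ → Ω → ℝ}

lemma exists_map_sum_eq_gaussianReal (hX : IsGaussianProcess X P)
    (hc : ∀ n, ∫ ω, X n ω ∂P = 0) (b : ℕ → ℝ) (s : Finset ℕ) :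
    ∃ v, P.map (fun ω => ∑ n ∈ s, b n * X n ω) = gaussianReal 0 v := by
  have := hX.isProbabilityMeasure
  have h1 := (hX.smul b).hasGaussianLaw_fun_sum (I := s)
  simp only [smul_eq_mul] at h1
  have h2 := h1.map_eq_gaussianReal
  rw [integral_finsetSum _ fun n _ => ((hX.hasGaussianLaw_eval n).integrable).const_mul (b n)] at h2
  simp only [integral_const_mul, hc, mul_zero, Finset.sum_const_zero] at h2
  exact ⟨_, h2⟩

/-- The standing summability condition on the coefficients of a random series `∑ b n * X n`,
which is convergence of the series of `L²` norms. -/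
def IsSquareConvergent (X : ℕ → Ω → ℝ) (P : Measure Ω) (b : ℕ → ℂ) : Prop :=
  ∑' n, ‖b n‖ₑ * eLpNorm (X n) 2 P ≠ ∞

/-- The random series `∑ b n * X n`. -/
def randomSum (X : ℕ → Ω → ℝ) (b : ℕ → ℂ) (ω : Ω) : ℂ := ∑' n, b n * (X n ω : ℂ)

lemma aemeasurable_mul_ofReal (hX : ∀ n, AEMeasurable (X n) P) (b : ℕ → ℂ) (n : ℕ) :
    AEMeasurable (fun ω => b n * (X n ω : ℂ)) P :=
  (Complex.measurable_ofReal.comp_aemeasurable (hX n)).const_mul _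

lemma eLpNorm_mul_ofReal (b : ℕ → ℂ) (n : ℕ) (q : ℝ≥0∞) :
    eLpNorm (fun ω => b n * (X n ω : ℂ)) q P = ‖b n‖ₑ * eLpNorm (X n) q P := by
  have : eLpNorm (fun ω => (X n ω : ℂ)) q P = eLpNorm (X n) q P :=
    eLpNorm_congr_norm_ae (by simp)
  rw [← this]
  exact eLpNorm_const_smul (b n) (fun ω => (X n ω : ℂ)) q P

lemma IsSquareConvergent.tsum_eLpNorm_ne_top {b : ℕ → ℂ} (hb : IsSquareConvergent X P b) :
    ∑' n, eLpNorm (fun ω => b n * (X n ω : ℂ)) 2 P ≠ ∞ := by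
  simp_rw [eLpNorm_mul_ofReal]
  exact hb

lemma IsSquareConvergent.ae_tsum_lt_top (hX : ∀ n, AEMeasurable (X n) P) {b : ℕ → ℂ}
    (hb : IsSquareConvergent X P b) :
    ∀ᵐ ω ∂P, ∑' n, ‖b n * (X n ω : ℂ)‖ₑ < ∞ :=
  ae_tsum_enorm_lt_top (aemeasurable_mul_ofReal hX b) hb.tsum_eLpNorm_ne_top

lemma IsSquareConvergent.ae_summable (hX : ∀ n, AEMeasurable (X n) P) {b : ℕ → ℂ}
    (hb : IsSquareConvergent X P b) : ∀ᵐ ω ∂P, Summable fun n => b n * (X n ω : ℂ) := by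
  filter_upwards [hb.ae_tsum_lt_top hX] with ω hω
  exact Summable.of_enorm hω.ne

lemma aemeasurable_randomSum (hX : ∀ n, AEMeasurable (X n) P) {b : ℕ → ℂ}
    (hb : IsSquareConvergent X P b) : AEMeasurable (randomSum X b) P := by
  refine aemeasurable_of_tendsto_metrizable_ae atTop
    (f := fun N ω => ∑ n ∈ Finset.range N, b n * (X n ω : ℂ))
    (fun N => Finset.aemeasurable_fun_sum _ fun n _ => aemeasurable_mul_ofReal hX b n) ?_
  filter_upwards [hb.ae_summable hX] with ω hω using hω.hasSum.tendsto_sum_nat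

lemma eLpNorm_randomSum_le (hX : ∀ n, AEMeasurable (X n) P) {b : ℕ → ℂ} :
    eLpNorm (randomSum X b) 2 P ≤ ∑' n, ‖b n‖ₑ * eLpNorm (X n) 2 P := by
  simp_rw [← eLpNorm_mul_ofReal]
  refine le_trans ?_ (eLpNorm_two_tsum_enorm_le (aemeasurable_mul_ofReal hX b))
  refine eLpNorm_mono_enorm fun ω => ?_
  rw [enorm_eq_self]
  exact enorm_tsum_le_tsum_enorm

/-- The sum of a random series of jointly Gaussian variables has Gaussian parts. -/
lemma hasGaussianParts_randomSum (hX : IsGaussianProcess X P)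
    (hc : ∀ n, ∫ ω, X n ω ∂P = 0) {b : ℕ → ℂ} (hb : IsSquareConvergent X P b) :
    HasGaussianParts (randomSum X b) P := by
  have := hX.isProbabilityMeasure
  have hm := hX.aemeasurable
  let W : Ω → ℝ≥0∞ := fun ω => ∑' n, ‖b n * (X n ω : ℂ)‖ₑ
  have hWm : AEMeasurable W P :=
    AEMeasurable.tsum fun n => (aemeasurable_mul_ofReal hm b n).enorm
  have hW : Integrable (fun ω => (W ω).toReal ^ 2) P := by
    have h1 : eLpNorm (fun ω => (W ω).toReal) 2 P < ∞ := by
      have h2 := (eLpNorm_two_tsum_enorm_le (aemeasurable_mul_ofReal hm b)).trans_lt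
        hb.tsum_eLpNorm_ne_top.lt_top
      refine (eLpNorm_mono_enorm fun ω => ?_).trans_lt h2
      rw [Real.enorm_eq_ofReal ENNReal.toReal_nonneg]
      exact ENNReal.ofReal_toReal_le
    exact MemLp.integrable_sq ⟨hWm.ennreal_toReal.aestronglyMeasurable, h1⟩
  -- The real and the imaginary part have the same shape, with real coefficients `c`.
  have key : ∀ (c : ℕ → ℝ) (V : Ω → ℝ), (∀ n, |c n| ≤ ‖b n‖) →
      (∀ ω, (Summable fun n => b n * (X n ω : ℂ)) → HasSum (fun n => c n * X n ω) (V ω)) →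
      ∃ v, P.map V = gaussianReal 0 v := by
    intro c V hcb hV
    refine exists_map_eq_gaussianReal_of_tendsto
      (U := fun N ω => ∑ n ∈ Finset.range N, c n * X n ω)
      (fun N => Finset.aemeasurable_fun_sum _ fun n _ => (hm n).const_mul _)
      (fun N => exists_map_sum_eq_gaussianReal hX hc c _) hW (fun N => ?_) ?_
    · filter_upwards [hb.ae_tsum_lt_top hm] with ω hω
      rw [← ENNReal.ofReal_le_iff_le_toReal hω.ne, ← Real.norm_eq_abs, ofReal_norm]
      calc ‖∑ n ∈ Finset.range N, c n * X n ω‖ₑ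
          ≤ ∑ n ∈ Finset.range N, ‖c n * X n ω‖ₑ := enorm_sum_le _ _
        _ ≤ ∑ n ∈ Finset.range N, ‖b n * (X n ω : ℂ)‖ₑ := by
          refine Finset.sum_le_sum fun n _ => enorm_le_iff_norm_le.2 ?_
          rw [norm_mul, norm_mul, Complex.norm_real]
          exact mul_le_mul_of_nonneg_right (hcb n) (norm_nonneg _)
        _ ≤ W ω := ENNReal.sum_le_tsum _
    · filter_upwards [hb.ae_summable hm] with ω hω
      exact (hV ω hω).tendsto_sum_nat
  refine ⟨aemeasurable_randomSum hm hb, key (fun n => (b n).re) _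
    (fun n => Complex.abs_re_le_norm _) fun ω hω => ?_, key (fun n => (b n).im) _
    (fun n => Complex.abs_im_le_norm _) fun ω hω => ?_⟩
  · simpa [randomSum] using Complex.hasSum_re hω.hasSum
  · simpa [randomSum] using Complex.hasSum_im hω.hasSum

end

/-! ### Minkowski's integral inequality -/

section Minkowski

variable {α β : Type*} [MeasurableSpace α] [MeasurableSpace β] {μ : Measure α} {ν : Measure β}
  [SFinite μ]

/-- Minkowski's integral inequality with a nonvanishing majorant `w` of the inner norms on the right.
It is Jensen's inequality for `h x / w` and the measure with density `w`. -/
lemma lintegral_lintegral_rpow_le_of_majorant [SFinite ν] {h : α → β → ℝ≥0∞}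
    (hh : AEMeasurable (Function.uncurry h) (μ.prod ν)) {q : ℝ} (hq : 1 ≤ q) {w : β → ℝ≥0∞}
    (hwm : AEMeasurable w ν) (hw0 : ∀ y, w y ≠ 0) (hw : ∀ y, ∫⁻ x, h x y ^ q ∂μ ≤ w y ^ q) :
    ∫⁻ x, (∫⁻ y, h x y ∂ν) ^ q ∂μ ≤ (∫⁻ y, w y ∂ν) ^ q := by
  have hq0 : 0 < q := zero_lt_one.trans_le hq
  by_cases hS : ∫⁻ y, w y ∂ν = ∞
  · rw [hS, ENNReal.top_rpow_of_pos hq0]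
    exact le_top
  have hwt : ∀ᵐ y ∂ν, w y < ∞ := ae_lt_top' hwm hS
  have hS' : ν.withDensity w Set.univ = ∫⁻ y, w y ∂ν := by
    rw [withDensity_apply _ MeasurableSet.univ, Measure.restrict_univ]
  have hmeas : ∀ᵐ x ∂μ, AEMeasurable (h x) ν := by
    filter_upwards [hh.aestronglyMeasurable.prodMk_left] with x hx using hx.aemeasurable
  have h1 : ∀ᵐ x ∂μ, (∫⁻ y, h x y ∂ν) ^ q ≤
      (∫⁻ y, w y ∂ν) ^ (q - 1) * ∫⁻ y, w y * (h x y / w y) ^ q ∂ν := by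
    filter_upwards [hmeas] with x hx
    have hg : AEMeasurable (fun y => h x y / w y) ν := hx.div hwm
    have e1 : ∫⁻ y, h x y ∂ν = eLpNorm' (fun y => h x y / w y) 1 (ν.withDensity w) := by
      simp only [eLpNorm', enorm_eq_self, ENNReal.rpow_one, div_one]
      rw [lintegral_withDensity_eq_lintegral_mul₀ hwm hg]
      refine lintegral_congr_ae ?_
      filter_upwards [hwt] with y hy
      simp only [Pi.mul_apply]
      rw [mul_comm, ENNReal.div_mul_cancel (hw0 y) hy.ne]
    have e2 : ∫⁻ y, w y * (h x y / w y) ^ q ∂ν =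
        eLpNorm' (fun y => h x y / w y) q (ν.withDensity w) ^ q := by
      simp only [eLpNorm', enorm_eq_self]
      rw [← ENNReal.rpow_mul, one_div, inv_mul_cancel₀ hq0.ne', ENNReal.rpow_one,
        lintegral_withDensity_eq_lintegral_mul₀ hwm (hg.pow_const q)]
      rfl
    rw [e1, e2, ← hS', mul_comm]
    have := eLpNorm'_le_eLpNorm'_mul_rpow_measure_univ (μ := ν.withDensity w) zero_lt_one hq
      (hg.mono_ac (withDensity_absolutelyContinuous ν w)).aestronglyMeasurable
    refine (ENNReal.rpow_le_rpow this hq0.le).trans (le_of_eq ?_)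
    rw [ENNReal.mul_rpow_of_nonneg _ _ hq0.le, ← ENNReal.rpow_mul]
    congr 2
    field_simp
  have hh2 : AEMeasurable (Function.uncurry fun x y => w y * (h x y / w y) ^ q) (μ.prod ν) := by
    have hw2 : AEMeasurable (fun z : α × β => w z.2) (μ.prod ν) := hwm.comp_snd
    exact hw2.mul ((hh.div hw2).pow_const q)
  calc ∫⁻ x, (∫⁻ y, h x y ∂ν) ^ q ∂μ
      ≤ ∫⁻ x, (∫⁻ y, w y ∂ν) ^ (q - 1) * ∫⁻ y, w y * (h x y / w y) ^ q ∂ν ∂μ :=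
        lintegral_mono_ae h1
    _ = (∫⁻ y, w y ∂ν) ^ (q - 1) * ∫⁻ y, ∫⁻ x, w y * (h x y / w y) ^ q ∂μ ∂ν := by
        rw [lintegral_const_mul' _ _ (ENNReal.rpow_ne_top_of_nonneg (by linarith) hS),
          lintegral_lintegral_swap hh2]
    _ ≤ (∫⁻ y, w y ∂ν) ^ (q - 1) * ∫⁻ y, w y ∂ν := by
        gcongr (_ * ?_)
        refine lintegral_mono_ae ?_
        filter_upwards [hwt] with y hy
        have e3 : ∀ x, w y * (h x y / w y) ^ q = (w y * (w y ^ q)⁻¹) * h x y ^ q := fun x => by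
          rw [ENNReal.div_rpow_of_nonneg _ _ hq0.le, div_eq_mul_inv]
          ring
        have hne : w y * (w y ^ q)⁻¹ ≠ ∞ := ENNReal.mul_ne_top hy.ne
          (ENNReal.inv_ne_top.2 fun h0 => hw0 y ((ENNReal.rpow_eq_zero_iff_of_pos hq0).1 h0))
        simp_rw [e3]
        rw [lintegral_const_mul' _ _ hne]
        calc w y * (w y ^ q)⁻¹ * ∫⁻ x, h x y ^ q ∂μ ≤ w y * (w y ^ q)⁻¹ * w y ^ q := by
              gcongr; exact hw y
          _ ≤ w y := by
              rw [mul_assoc]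
              exact mul_le_of_le_one_right' (ENNReal.inv_mul_le_one _)
    _ = (∫⁻ y, w y ∂ν) ^ q := by
        nth_rewrite 2 [← ENNReal.rpow_one (∫⁻ y, w y ∂ν)]
        rw [← ENNReal.rpow_add_of_nonneg _ _ (by linarith) zero_le_one, sub_add_cancel]

/-- **Minkowski's integral inequality**. -/
lemma lintegral_lintegral_rpow_le [IsFiniteMeasure ν] {h : α → β → ℝ≥0∞}
    (hh : AEMeasurable (Function.uncurry h) (μ.prod ν)) {q : ℝ} (hq : 1 ≤ q) :
    (∫⁻ x, (∫⁻ y, h x y ∂ν) ^ q ∂μ) ^ q⁻¹ ≤ ∫⁻ y, (∫⁻ x, h x y ^ q ∂μ) ^ q⁻¹ ∂ν := by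
  have hq0 : 0 < q := zero_lt_one.trans_le hq
  -- Adding a constant makes the majorant positive.
  have key : ∀ δ : ℝ≥0, 0 < δ → (∫⁻ x, (∫⁻ y, h x y ∂ν) ^ q ∂μ) ^ q⁻¹ ≤
      ∫⁻ y, (∫⁻ x, h x y ^ q ∂μ) ^ q⁻¹ ∂ν + δ * ν Set.univ := fun δ hδ => by
    have hm : AEMeasurable (fun y => (∫⁻ x, h x y ^ q ∂μ) ^ q⁻¹) ν :=
      (AEMeasurable.lintegral_prod_left' (f := fun z : α × β => h z.1 z.2 ^ q)
        (hh.pow_const q)).pow_const _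
    rw [ENNReal.rpow_inv_le_iff hq0, ← lintegral_const, ← lintegral_add_left' hm]
    refine lintegral_lintegral_rpow_le_of_majorant hh hq (hm.add_const _) (fun y => ?_) fun y => ?_
    · simp [hδ.ne']
    · calc ∫⁻ x, h x y ^ q ∂μ = ((∫⁻ x, h x y ^ q ∂μ) ^ q⁻¹) ^ q := by
            rw [← ENNReal.rpow_mul, inv_mul_cancel₀ hq0.ne', ENNReal.rpow_one]
        _ ≤ _ := by gcongr; exact le_self_add
  have hlim : Tendsto (fun δ : ℝ≥0 => ∫⁻ y, (∫⁻ x, h x y ^ q ∂μ) ^ q⁻¹ ∂ν + δ * ν Set.univ)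
      (𝓝[>] 0) (𝓝 (∫⁻ y, (∫⁻ x, h x y ^ q ∂μ) ^ q⁻¹ ∂ν + (0 : ℝ≥0) * ν Set.univ)) := by
    refine Tendsto.const_add _ (ENNReal.Tendsto.mul_const ?_ (Or.inr (measure_ne_top _ _)))
    exact (ENNReal.continuous_coe.tendsto 0).mono_left nhdsWithin_le_nhds
  simp only [ENNReal.coe_zero, zero_mul, add_zero] at hlim
  exact ge_of_tendsto hlim (eventually_mem_nhdsWithin.mono fun δ hδ => key δ hδ)

/-- Minkowski's inequality for mixed norms: the larger exponent is cheaper on the inside. -/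
lemma eLpNorm_eLpNorm_swap_le [IsFiniteMeasure ν] {F : α → β → ℂ}
    (hF : AEMeasurable (Function.uncurry F) (μ.prod ν)) {p s : ℝ≥0∞} (hp0 : p ≠ 0)
    (hps : p ≤ s) (hs : s ≠ ∞) :
    eLpNorm (fun x => eLpNorm (F x) p ν) s μ ≤
      eLpNorm (fun y => eLpNorm (fun x => F x y) s μ) p ν := by
  have hp : p ≠ ∞ := ne_top_of_le_ne_top hs hps
  have hs0 : s ≠ 0 := fun h => hp0 (by simpa [h] using hps)
  have hp' : 0 < p.toReal := ENNReal.toReal_pos hp0 hp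
  have hs' : 0 < s.toReal := ENNReal.toReal_pos hs0 hs
  have hq : 1 ≤ s.toReal / p.toReal := by
    rw [one_le_div hp']; exact ENNReal.toReal_mono hs hps
  have h := lintegral_lintegral_rpow_le (μ := μ) (ν := ν) (h := fun x y => ‖F x y‖ₑ ^ p.toReal)
    (hF.enorm.pow_const _) hq
  have h' := ENNReal.rpow_le_rpow h (inv_nonneg.2 hp'.le)
  simp only [eLpNorm_eq_lintegral_rpow_enorm_toReal hp0 hp,
    eLpNorm_eq_lintegral_rpow_enorm_toReal hs0 hs, enorm_eq_self, ← ENNReal.rpow_mul]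
  simp only [← ENNReal.rpow_mul] at h'
  have e1 : 1 / p.toReal * s.toReal = s.toReal / p.toReal := by ring
  have e2 : (s.toReal / p.toReal)⁻¹ * p.toReal⁻¹ = 1 / s.toReal := by field_simp
  have e3 : p.toReal * (s.toReal / p.toReal) = s.toReal := by field_simp
  have e4 : 1 / s.toReal * p.toReal = (s.toReal / p.toReal)⁻¹ := by field_simp
  rw [e2, e3, inv_eq_one_div p.toReal] at h'
  rw [e1, e4]
  exact h'

end Minkowski

/-! ### Randomized power series -/

section

variable {Ω : Type*} {X : ℕ → Ω → ℝ}

/-- The value at `z` of the randomization of `∑ a n * z ^ n`, as a random series. -/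
def randomValue (X : ℕ → Ω → ℝ) (a : ℕ → ℂ) (z : ℂ) : Ω → ℂ :=
  randomSum X fun n => a n * z ^ n

lemma randomValue_eq_powerSum (a : ℕ → ℂ) (z : ℂ) (ω : Ω) :
    randomValue X a z ω = powerSum (fun n => a n * (X n ω : ℂ)) z :=
  tsum_congr fun n => by ring

lemma randomization_eq_powerSum (f : ℂ → ℂ) (ω : Ω) :
    randomization X f ω = powerSum fun n => taylorCoeff f n * (X n ω : ℂ) := rfl

variable [MeasurableSpace Ω] {P : Measure Ω}

/-- The standard deviations of the process grow so slowly that `∑ ‖X n‖₂ r ^ n` converges for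
every `r < 1`. -/
def HasTemperedGrowth (X : ℕ → Ω → ℝ) (P : Measure Ω) : Prop :=
  ∀ r : ℝ, 0 ≤ r → r < 1 → ∑' n, ‖r‖ₑ ^ n * eLpNorm (X n) 2 P ≠ ∞

/-- A sequence bounded by a finite constant. -/
def IsBoundedSeq (a : ℕ → ℂ) : Prop := ∃ C : ℝ≥0, ∀ n, ‖a n‖ₑ ≤ C

lemma IsBoundedSeq.isSquareConvergent {a : ℕ → ℂ} (ha : IsBoundedSeq a)
    (hg : HasTemperedGrowth X P) {z : ℂ} (hz : ‖z‖ < 1) :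
    IsSquareConvergent X P fun n => a n * z ^ n := by
  obtain ⟨C, hC⟩ := ha
  have h := hg ‖z‖ (norm_nonneg z) hz
  refine ne_top_of_le_ne_top (ENNReal.mul_ne_top (ENNReal.coe_ne_top (r := C)) h) ?_
  rw [← ENNReal.tsum_mul_left]
  refine ENNReal.tsum_le_tsum fun n => ?_
  rw [enorm_mul, enorm_pow, mul_assoc, enorm_norm]
  gcongr
  exact hC n

lemma ae_convergesOnDisk (hX : ∀ n, AEMeasurable (X n) P) (hg : HasTemperedGrowth X P)
    {a : ℕ → ℂ} (ha : IsBoundedSeq a) :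
    ∀ᵐ ω ∂P, ConvergesOnDisk fun n => a n * (X n ω : ℂ) := by
  have h : ∀ k, ∀ᵐ ω ∂P, Summable fun n => a n * (radius k : ℂ) ^ n * (X n ω : ℂ) := fun k =>
    (ha.isSquareConvergent hg (by
      rw [Complex.norm_real, Real.norm_of_nonneg (radius_mem k).1.le]
      exact (radius_mem k).2)).ae_summable hX
  filter_upwards [ae_all_iff.2 h] with ω hω r h0 h1
  obtain ⟨k, hk⟩ := exists_le_radius h1
  refine Summable.of_nonneg_of_le (fun n => by positivity) (fun n => ?_) (hω k).norm
  rw [norm_mul, norm_mul, norm_mul, norm_pow, Complex.norm_real (radius k),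
    Real.norm_of_nonneg (radius_mem k).1.le, mul_right_comm]
  gcongr

lemma aemeasurable_uncurry_randomValue [SFinite P] (hX : ∀ n, AEMeasurable (X n) P)
    (hg : HasTemperedGrowth X P) {a : ℕ → ℂ} (ha : IsBoundedSeq a) {r : ℝ} (h0 : 0 ≤ r)
    (h1 : r < 1) :
    AEMeasurable (Function.uncurry fun ω θ => randomValue X a (circleMap 0 r θ) ω)
      (P.prod arcMeasure) := by
  have hX' : ∀ n, AEMeasurable (fun y : Ω × ℝ => X n y.1) (P.prod arcMeasure) :=
    fun n => (hX n).comp_fst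
  refine aemeasurable_of_tendsto_metrizable_ae atTop (f := fun N y =>
    ∑ n ∈ Finset.range N, a n * circleMap 0 r y.2 ^ n * (X n y.1 : ℂ)) (fun N => ?_) ?_
  · refine Finset.aemeasurable_fun_sum _ fun n _ => AEMeasurable.mul ?_
      (Complex.measurable_ofReal.comp_aemeasurable (hX' n))
    have h2 : Measurable fun y : Ω × ℝ => circleMap 0 r y.2 :=
      (continuous_circleMap 0 r).measurable.comp measurable_snd
    exact ((h2.pow_const n).const_mul _).aemeasurable
  · have := (Measure.quasiMeasurePreserving_fst (μ := P) (ν := arcMeasure)).ae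
      (ae_convergesOnDisk hX hg ha)
    filter_upwards [this] with y hy
    have := (hy.summable (z := circleMap 0 r y.2)
      (by simpa using circleMap_zero_mem_ball h0 h1 y.2)).hasSum.tendsto_sum_nat
    simp only [Function.uncurry]
    rw [randomValue_eq_powerSum]
    refine this.congr fun N => Finset.sum_congr rfl fun n _ => by ring

/-- The `L^p` norm over the circle of radius `r` of the standard deviation of the randomization of
`∑ a n * z ^ n`. -/
def circleDeviation (X : ℕ → Ω → ℝ) (P : Measure Ω) (p : ℝ≥0∞) (r : ℝ) (a : ℕ → ℂ) : ℝ≥0∞ :=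
  eLpNorm (fun θ : ℝ => eLpNorm (randomValue X a (circleMap 0 r θ)) 2 P) p arcMeasure

lemma eLpNorm_two_circleMean_le (hX : IsGaussianProcess X P) (hc : ∀ n, ∫ ω, X n ω ∂P = 0)
    (hg : HasTemperedGrowth X P) {a : ℕ → ℂ} (ha : IsBoundedSeq a) {r : ℝ} (h0 : 0 ≤ r)
    (h1 : r < 1) {p : ℝ≥0∞} (hp1 : 1 ≤ p) (hp : p ≠ ∞) :
    eLpNorm (fun ω => eLpNorm (fun θ => randomValue X a (circleMap 0 r θ) ω) p arcMeasure) 2 P ≤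
      2 * gaussianMoment (max p 2) / gaussianMoment 2 * circleDeviation X P p r a := by
  have := hX.isProbabilityMeasure
  have hp0 : p ≠ 0 := (zero_lt_one.trans_le hp1).ne'
  have hs : max p 2 ≠ ∞ := by simp [hp]
  have hK : 2 * gaussianMoment (max p 2) / gaussianMoment 2 ≠ ∞ :=
    ENNReal.div_ne_top (ENNReal.mul_ne_top (by simp) (gaussianMoment_ne_top hs))
      gaussianMoment_two_ne_zero
  have hm := aemeasurable_uncurry_randomValue hX.aemeasurable hg ha h0 h1
  have hm1 : AEMeasurable
      (fun ω => eLpNorm (fun θ => randomValue X a (circleMap 0 r θ) ω) p arcMeasure) P := by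
    simp only [eLpNorm_eq_lintegral_rpow_enorm_toReal hp0 hp]
    exact (AEMeasurable.lintegral_prod_right' (hm.enorm.pow_const p.toReal)).pow_const _
  calc _ ≤ eLpNorm (fun ω => eLpNorm (fun θ => randomValue X a (circleMap 0 r θ) ω) p arcMeasure)
        (max p 2) P :=
        eLpNorm_le_eLpNorm_of_exponent_le (le_max_right _ _) hm1.aestronglyMeasurable
    _ ≤ eLpNorm (fun θ => eLpNorm (randomValue X a (circleMap 0 r θ)) (max p 2) P) p arcMeasure :=
        eLpNorm_eLpNorm_swap_le hm hp0 (le_max_left _ _) hs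
    _ ≤ (2 * gaussianMoment (max p 2) / gaussianMoment 2).toNNReal *
          circleDeviation X P p r a := by
        refine eLpNorm_le_mul_eLpNorm_of_ae_le_mul' (ae_of_all _ fun θ => ?_) p
        rw [ENNReal.coe_toNNReal hK, enorm_eq_self, enorm_eq_self]
        exact (hasGaussianParts_randomSum hX hc (ha.isSquareConvergent hg
          (by simpa using circleMap_zero_mem_ball h0 h1 θ))).eLpNorm_le
          (hp1.trans (le_max_left _ _))
    _ = _ := by rw [ENNReal.coe_toNNReal hK]

lemma isBoundedSeq_of_tsum_sq {a : ℕ → ℂ} (ha : ∑' n, ‖a n‖ₑ ^ 2 ≠ ∞) : IsBoundedSeq a := by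
  refine ⟨(∑' n, ‖a n‖ₑ ^ 2).toNNReal + 1, fun n => ?_⟩
  rw [ENNReal.coe_add, ENNReal.coe_toNNReal ha, ENNReal.coe_one]
  rcases le_total ‖a n‖ₑ 1 with h | h
  · exact h.trans le_add_self
  · exact (le_self_pow₀ h two_ne_zero).trans
      ((ENNReal.le_tsum (f := fun n => ‖a n‖ₑ ^ 2) n).trans le_self_add)

lemma tsum_taylorCoeff_sq_ne_top {f : ℂ → ℂ} (hf : MemHardy 2 f) :
    ∑' n, ‖taylorCoeff f n‖ₑ ^ 2 ≠ ∞ := by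
  rw [← hardyNorm_two_sq_eq_tsum_taylorCoeff hf.holomorphic]
  exact ENNReal.pow_ne_top hf.norm_lt_top.ne

lemma isBoundedSeq_taylorCoeff {f : ℂ → ℂ} (hf : MemHardy 2 f) : IsBoundedSeq (taylorCoeff f) :=
  isBoundedSeq_of_tsum_sq (tsum_taylorCoeff_sq_ne_top hf)

/-- A bound on the standard deviation of `R f` in the `L^p` norms over circles makes `R` bounded. -/
theorem randomizationBounded_of_circleDeviation_le (hX : IsGaussianProcess X P)
    (hc : ∀ n, ∫ ω, X n ω ∂P = 0) (hg : HasTemperedGrowth X P) {p : ℝ≥0∞} (hp1 : 1 ≤ p)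
    (hp : p ≠ ∞) (C : ℝ≥0) (hC : ∀ f : ℂ → ℂ, MemHardy 2 f → ∀ k,
      circleDeviation X P p (radius k) (taylorCoeff f) ≤ C * hardyNorm 2 f) :
    RandomizationBounded X P 2 p := by
  have := hX.isProbabilityMeasure
  have hp0 : p ≠ 0 := (zero_lt_one.trans_le hp1).ne'
  have hK : 2 * gaussianMoment (max p 2) / gaussianMoment 2 ≠ ∞ :=
    ENNReal.div_ne_top (ENNReal.mul_ne_top (by simp) (gaussianMoment_ne_top (by simp [hp])))
      gaussianMoment_two_ne_zero
  let M : (ℂ → ℂ) → ℕ → Ω → ℝ≥0∞ := fun f k ω =>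
    eLpNorm (fun θ => randomValue X (taylorCoeff f) (circleMap 0 (radius k) θ) ω) p arcMeasure
  have hMm : ∀ f, MemHardy 2 f → ∀ k, AEMeasurable (M f k) P := fun f hf k => by
    have hm := aemeasurable_uncurry_randomValue hX.aemeasurable hg (isBoundedSeq_taylorCoeff hf)
      (radius_mem k).1.le (radius_mem k).2
    simp only [M, eLpNorm_eq_lintegral_rpow_enorm_toReal hp0 hp]
    exact (AEMeasurable.lintegral_prod_right' (hm.enorm.pow_const p.toReal)).pow_const _
  have hconv : ∀ f, MemHardy 2 f →
      ∀ᵐ ω ∂P, ConvergesOnDisk fun n => taylorCoeff f n * (X n ω : ℂ) := fun f hf =>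
    ae_convergesOnDisk hX.aemeasurable hg (isBoundedSeq_taylorCoeff hf)
  have hMmono : ∀ f, MemHardy 2 f → ∀ᵐ ω ∂P, Monotone fun k => M f k ω := fun f hf => by
    filter_upwards [hconv f hf] with ω hω j k hjk
    simp only [M, randomValue_eq_powerSum]
    exact eLpNorm_powerSum_circle_mono hω (radius_mem j).1.le (radius_mono hjk) (radius_mem k).2
      hp1 hp
  have hnorm : ∀ f, MemHardy 2 f →
      (fun ω => hardyNorm p (randomization X f ω)) =ᵐ[P] fun ω => ⨆ k, M f k ω := fun f hf => by
    filter_upwards [hconv f hf] with ω hω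
    simp only [M, randomValue_eq_powerSum, randomization_eq_powerSum]
    exact hardyNorm_powerSum_eq_iSup hω hp1 hp
  have hbound : ∀ f, MemHardy 2 f → randomHardyNorm 2 p (randomization X f) P ≤
      2 * gaussianMoment (max p 2) / gaussianMoment 2 * (C * hardyNorm 2 f) := fun f hf => by
    rw [randomHardyNorm, eLpNorm_congr_ae (hnorm f hf),
      eLpNorm_eq_lintegral_rpow_enorm_toReal two_ne_zero (by simp), one_div,
      ENNReal.rpow_inv_le_iff (by simp)]
    have h1 : ∀ ω, ‖⨆ k, M f k ω‖ₑ ^ (2 : ℝ≥0∞).toReal =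
        ⨆ k, ‖M f k ω‖ₑ ^ (2 : ℝ≥0∞).toReal := fun ω => by
      simp only [enorm_eq_self]
      exact (ENNReal.orderIsoRpow _ (by simp)).map_iSup _
    simp_rw [h1]
    rw [lintegral_iSup' (fun k => ((hMm f hf k).enorm).pow_const _)]
    · refine iSup_le fun k => ?_
      rw [← ENNReal.rpow_inv_le_iff (by simp), ← one_div,
        ← eLpNorm_eq_lintegral_rpow_enorm_toReal two_ne_zero (by simp)]
      refine (eLpNorm_two_circleMean_le hX hc hg (isBoundedSeq_taylorCoeff hf)
        (radius_mem k).1.le (radius_mem k).2 hp1 hp).trans ?_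
      gcongr
      exact hC f hf k
    · filter_upwards [hMmono f hf] with ω hω j k hjk
      exact ENNReal.rpow_le_rpow (hω hjk) (by simp)
  have hfin : ∀ f, MemHardy 2 f → randomHardyNorm 2 p (randomization X f) P < ∞ := fun f hf =>
    (hbound f hf).trans_lt (ENNReal.mul_lt_top hK.lt_top
      (ENNReal.mul_lt_top ENNReal.coe_lt_top hf.norm_lt_top))
  have hmem : ∀ f, MemHardy 2 f → ∀ᵐ ω ∂P, MemHardy p (randomization X f ω) := fun f hf => by
    have h1 := hfin f hf
    rw [randomHardyNorm, eLpNorm_lt_top_iff_lintegral_rpow_enorm_lt_top two_ne_zero (by simp)] at h1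
    have h2 : AEMeasurable (fun ω => hardyNorm p (randomization X f ω)) P :=
      (AEMeasurable.iSup (hMm f hf)).congr (hnorm f hf).symm
    filter_upwards [ae_lt_top' (h2.enorm.pow_const _) h1.ne, hconv f hf] with ω h3 h4
    exact ⟨differentiableOn_powerSum h4, by simpa using h3⟩
  refine ⟨fun f hf => ⟨?_, fun z hz => ?_, hmem f hf, hfin f hf⟩,
    (2 * gaussianMoment (max p 2) / gaussianMoment 2).toNNReal * C, fun f hf => ?_⟩
  · filter_upwards [hmem f hf, hconv f hf] with ω h1 h2
    exact ⟨convergesOnDisk_iff.1 h2, h1⟩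
  · have := aemeasurable_randomSum hX.aemeasurable
      ((isBoundedSeq_taylorCoeff hf).isSquareConvergent hg (by simpa using hz))
    refine this.congr (ae_of_all _ fun ω => ?_)
    exact (randomValue_eq_powerSum _ _ _)
  · rw [ENNReal.coe_mul, ENNReal.coe_toNNReal hK, mul_assoc]
    exact hbound f hf

end

/-! ### Bounded covariance -/

section

variable {Ω : Type*} [MeasurableSpace Ω] {P : Measure Ω} {X : ℕ → Ω → ℝ}

/-- The second moment of a finite linear combination is a value of the quadratic form of the
covariance matrix. -/
lemma eLpNorm_two_sum_sq_le (hX : IsGaussianProcess X P) (hc : ∀ n, ∫ ω, X n ω ∂P = 0)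
    (T : lp (fun _ : ℕ => ℂ) 2 →L[ℂ] lp (fun _ : ℕ => ℂ) 2)
    (hT : ∀ (x : lp (fun _ : ℕ => ℂ) 2) (n : ℕ),
      HasSum (fun m => (covMatrix X P n m : ℂ) * x m) (T x n)) (b : ℕ → ℂ) (s : Finset ℕ) :
    eLpNorm (fun ω => ∑ n ∈ s, b n * (X n ω : ℂ)) 2 P ^ 2 ≤ ‖T‖ₑ * ∑ n ∈ s, ‖b n‖ₑ ^ 2 := by
  have := hX.isProbabilityMeasure
  have hL : ∀ n, MemLp (X n) 2 P := fun n => (hX.hasGaussianLaw_eval n).memLp_two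
  have hcov : ∀ n m, covMatrix X P n m = ∫ ω, X n ω * X m ω ∂P := fun n m => by
    simp [covMatrix, covariance, hc]
  have hint : ∀ n m, Integrable (fun ω => ((X n ω * X m ω : ℝ) : ℂ)) P := fun n m =>
    ((hL n).integrable_mul (hL m)).ofReal
  let x : lp (fun _ : ℕ => ℂ) 2 := ∑ n ∈ s, lp.single 2 n (b n)
  have hx : ‖x‖ ^ 2 = ∑ n ∈ s, ‖b n‖ ^ 2 := by
    have := lp.norm_sum_single (E := fun _ : ℕ => ℂ) (p := 2) (by simp) b s
    simpa [x] using this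
  have hxm : ∀ m, x m = if m ∈ s then b m else 0 := fun m => by
    simp only [x, lp.coeFn_sum, lp.coeFn_single, Finset.sum_apply, Finset.sum_pi_single]
  have hTx : ∀ n, T x n = ∑ m ∈ s, (covMatrix X P n m : ℂ) * b m := fun n => by
    refine (hT x n).unique ?_
    have : HasSum (fun m => (covMatrix X P n m : ℂ) * x m)
        (∑ m ∈ s, (covMatrix X P n m : ℂ) * x m) :=
      hasSum_sum_of_ne_finset_zero fun m hm => by simp [hxm, hm]
    convert this using 1
    exact Finset.sum_congr rfl fun m hm => by simp [hxm, hm]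
  have hinner : inner ℂ x (T x) =
      ((∫ ω, ‖∑ n ∈ s, b n * (X n ω : ℂ)‖ ^ 2 ∂P : ℝ) : ℂ) := by
    calc inner ℂ x (T x) = ∑ n ∈ s, ∑ m ∈ s,
          starRingEnd ℂ (b n) * b m * ∫ ω, ((X n ω * X m ω : ℝ) : ℂ) ∂P := by
          simp only [x, sum_inner, lp.inner_single_left]
          refine Finset.sum_congr rfl fun n _ => ?_
          rw [hTx, RCLike.inner_apply, Finset.sum_mul]
          refine Finset.sum_congr rfl fun m _ => ?_
          rw [hcov, integral_complex_ofReal]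
          ring
      _ = ∫ ω, ∑ n ∈ s, ∑ m ∈ s, starRingEnd ℂ (b n) * b m * ((X n ω * X m ω : ℝ) : ℂ) ∂P := by
          rw [integral_finsetSum _ fun n _ => integrable_finsetSum _ fun m _ =>
            (hint n m).const_mul _]
          refine Finset.sum_congr rfl fun n _ => ?_
          rw [integral_finsetSum _ fun m _ => (hint n m).const_mul _]
          exact Finset.sum_congr rfl fun m _ => (integral_const_mul _ _).symm
      _ = ∫ ω, ((‖∑ n ∈ s, b n * (X n ω : ℂ)‖ ^ 2 : ℝ) : ℂ) ∂P := by
          congr 1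
          ext ω
          rw [Complex.ofReal_pow, ← Complex.conj_mul', map_sum, Finset.sum_mul_sum]
          refine Finset.sum_congr rfl fun n _ => Finset.sum_congr rfl fun m _ => ?_
          rw [map_mul, Complex.conj_ofReal, Complex.ofReal_mul]
          ring
      _ = _ := integral_complex_ofReal
  have hreal : ∫ ω, ‖∑ n ∈ s, b n * (X n ω : ℂ)‖ ^ 2 ∂P ≤ ‖T‖ * ∑ n ∈ s, ‖b n‖ ^ 2 := by
    rw [← hx]
    have h1 : ‖inner ℂ x (T x)‖ ≤ ‖x‖ * (‖T‖ * ‖x‖) :=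
      (norm_inner_le_norm x (T x)).trans (by gcongr; exact T.le_opNorm x)
    rw [hinner, Complex.norm_real] at h1
    calc _ ≤ _ := le_abs_self _
      _ ≤ _ := h1
      _ = _ := by ring
  have hmem : MemLp (fun ω => ∑ n ∈ s, b n * (X n ω : ℂ)) 2 P :=
    memLp_finsetSum _ fun n _ => (hL n).ofReal.const_mul _
  have h2 : eLpNorm (fun ω => ∑ n ∈ s, b n * (X n ω : ℂ)) 2 P ^ 2 =
      ENNReal.ofReal (∫ ω, ‖∑ n ∈ s, b n * (X n ω : ℂ)‖ ^ 2 ∂P) := by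
    rw [hmem.eLpNorm_eq_integral_rpow_norm two_ne_zero (by simp),
      ← ENNReal.ofReal_pow (by positivity)]
    congr 1
    rw [← Real.rpow_natCast, ← Real.rpow_mul (by positivity)]
    simp
  rw [h2]
  refine (ENNReal.ofReal_le_ofReal hreal).trans (le_of_eq ?_)
  rw [ENNReal.ofReal_mul (norm_nonneg _), ofReal_norm,
    ENNReal.ofReal_sum_of_nonneg fun n _ => by positivity]
  simp_rw [ENNReal.ofReal_pow (norm_nonneg _), ofReal_norm]

lemma eLpNorm_two_randomSum_sq_le (hX : IsGaussianProcess X P) (hc : ∀ n, ∫ ω, X n ω ∂P = 0)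
    (T : lp (fun _ : ℕ => ℂ) 2 →L[ℂ] lp (fun _ : ℕ => ℂ) 2)
    (hT : ∀ (x : lp (fun _ : ℕ => ℂ) 2) (n : ℕ),
      HasSum (fun m => (covMatrix X P n m : ℂ) * x m) (T x n)) {b : ℕ → ℂ}
    (hb : IsSquareConvergent X P b) :
    eLpNorm (randomSum X b) 2 P ^ 2 ≤ ‖T‖ₑ * ∑' n, ‖b n‖ₑ ^ 2 := by
  have h1 : eLpNorm (randomSum X b) 2 P ≤ (‖T‖ₑ * ∑' n, ‖b n‖ₑ ^ 2) ^ ((2 : ℕ) : ℝ)⁻¹ := by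
    refine (Lp.eLpNorm_lim_le_liminf_eLpNorm
      (f := fun N ω => ∑ n ∈ Finset.range N, b n * (X n ω : ℂ))
      (fun N => (Finset.aemeasurable_fun_sum _ fun n _ =>
        aemeasurable_mul_ofReal hX.aemeasurable b n).aestronglyMeasurable) _ ?_).trans ?_
    · filter_upwards [hb.ae_summable hX.aemeasurable] with ω hω using hω.hasSum.tendsto_sum_nat
    · refine liminf_le_of_le (by isBoundedDefault) fun c hc' => ?_
      obtain ⟨N, hN⟩ := hc'.exists
      refine hN.trans ?_
      rw [ENNReal.le_rpow_inv_iff (by simp), ENNReal.rpow_natCast]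
      refine (eLpNorm_two_sum_sq_le hX hc T hT b _).trans ?_
      gcongr
      exact ENNReal.sum_le_tsum _
  rwa [ENNReal.le_rpow_inv_iff (by simp), ENNReal.rpow_natCast] at h1

lemma hasTemperedGrowth_of_le {C : ℝ≥0} (h : ∀ n, eLpNorm (X n) 2 P ≤ C) :
    HasTemperedGrowth X P := by
  intro r h0 h1
  refine ne_top_of_le_ne_top (b := ∑' n, ‖r‖ₑ ^ n * C) ?_ (ENNReal.tsum_le_tsum fun n => ?_)
  · rw [ENNReal.tsum_mul_right, ENNReal.tsum_geometric]
    refine ENNReal.mul_ne_top (ENNReal.inv_ne_top.2 ?_) ENNReal.coe_ne_top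
    rw [Real.enorm_of_nonneg h0]
    exact (tsub_pos_of_lt (ENNReal.ofReal_lt_one.2 h1)).ne'
  · gcongr
    exact h n

theorem randomizationBounded_of_isBoundedOnEllTwo (hX : IsGaussianProcess X P)
    (hc : ∀ n, ∫ ω, X n ω ∂P = 0) (hK : IsBoundedOnEllTwo (covMatrix X P)) {p : ℝ≥0∞}
    (hp1 : 1 ≤ p) (hp : p ≠ ∞) : RandomizationBounded X P 2 p := by
  obtain ⟨T, hT⟩ := hK
  have hp0 : p ≠ 0 := (zero_lt_one.trans_le hp1).ne'
  have hroot : ∀ {u v : ℝ≥0∞}, u ^ 2 ≤ ‖T‖ₑ * v ^ 2 → u ≤ NNReal.sqrt ‖T‖₊ * v := fun h => by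
    rw [← ENNReal.pow_le_pow_left_iff two_ne_zero, mul_pow, ← ENNReal.coe_pow, NNReal.sq_sqrt]
    exact h
  have hg : HasTemperedGrowth X P := by
    refine hasTemperedGrowth_of_le (C := NNReal.sqrt ‖T‖₊) fun n => ?_
    have h1 := eLpNorm_two_sum_sq_le hX hc T hT (fun _ => 1) {n}
    simp only [Finset.sum_singleton] at h1
    rw [eLpNorm_mul_ofReal (fun _ => 1) n] at h1
    simpa using hroot (u := eLpNorm (X n) 2 P) (v := 1) (by simpa using h1)
  refine randomizationBounded_of_circleDeviation_le hX hc hg hp1 hp (NNReal.sqrt ‖T‖₊)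
    fun f hf k => ?_
  have h2 : ∀ θ, eLpNorm (randomValue X (taylorCoeff f) (circleMap 0 (radius k) θ)) 2 P ≤
      NNReal.sqrt ‖T‖₊ * hardyNorm 2 f := fun θ => by
    have hz : ‖circleMap 0 (radius k) θ‖ < 1 := by
      simpa using circleMap_zero_mem_ball (radius_mem k).1.le (radius_mem k).2 θ
    refine hroot ?_
    rw [hardyNorm_two_sq_eq_tsum_taylorCoeff hf.holomorphic]
    refine (eLpNorm_two_randomSum_sq_le hX hc T hT
      ((isBoundedSeq_taylorCoeff hf).isSquareConvergent hg hz)).trans ?_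
    gcongr with n
    rw [enorm_mul, enorm_pow]
    refine mul_le_of_le_one_right' (pow_le_one₀ zero_le ?_)
    rw [← ofReal_norm]
    exact ENNReal.ofReal_le_one.2 hz.le
  calc circleDeviation X P p (radius k) (taylorCoeff f)
      ≤ eLpNorm (fun _ : ℝ => (NNReal.sqrt ‖T‖₊ * hardyNorm 2 f : ℝ≥0∞)) p arcMeasure :=
        eLpNorm_mono_enorm fun θ => by simpa using h2 θ
    _ = _ := by
        rw [eLpNorm_eq_lintegral_rpow_enorm_toReal hp0 hp, lintegral_const, measure_univ, mul_one,
          enorm_eq_self, ← ENNReal.rpow_mul,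
          mul_one_div_cancel (ENNReal.toReal_pos hp0 hp).ne', ENNReal.rpow_one]

end

/-! ### Almost sure membership implies boundedness -/

section

variable {Ω : Type*} [MeasurableSpace Ω] {P : Measure Ω} {X : ℕ → Ω → ℝ}

lemma hasGaussianParts_mul_ofReal (hX : IsGaussianProcess X P) (hc : ∀ n, ∫ ω, X n ω ∂P = 0)
    (b : ℂ) (n : ℕ) : HasGaussianParts (fun ω => b * (X n ω : ℂ)) P := by
  have h1 : IsSquareConvergent X P (Pi.single n b) := by
    have := hX.isProbabilityMeasure
    rw [IsSquareConvergent, tsum_eq_single n fun m hm => by simp [hm]]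
    exact ENNReal.mul_ne_top (by simp) (hX.hasGaussianLaw_eval n).memLp_two.eLpNorm_ne_top
  have h2 : randomSum X (Pi.single n b) = fun ω => b * (X n ω : ℂ) := by
    ext ω
    rw [randomSum, tsum_eq_single n fun m hm => by simp [hm]]
    simp
  rw [← h2]
  exact hasGaussianParts_randomSum hX hc h1

/-- If a sequence of multiples of the `X n` tends to `0` almost surely, their standard deviations
are eventually bounded. -/
lemma exists_eventually_eLpNorm_le (hX : IsGaussianProcess X P) (hc : ∀ n, ∫ ω, X n ω ∂P = 0)
    {b : ℕ → ℂ} (hb : ∀ᵐ ω ∂P, Tendsto (fun n => b n * (X n ω : ℂ)) atTop (𝓝 0)) :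
    ∃ C : ℝ≥0, ∀ᶠ n in atTop, ‖b n‖ₑ * eLpNorm (X n) 2 P ≤ C := by
  have := hX.isProbabilityMeasure
  obtain ⟨ε, hε0, hεt, hε⟩ := exists_measure_enorm_lt_le P
  have h1 : TendstoInMeasure P (fun n ω => b n * (X n ω : ℂ)) atTop fun _ => 0 :=
    tendstoInMeasure_of_tendsto_ae
      (fun n => (aemeasurable_mul_ofReal hX.aemeasurable b n).aestronglyMeasurable) hb
  have h2 := (h1 1 one_pos).eventually (gt_mem_nhds (show (0 : ℝ≥0∞) < 1 / 2 by simp))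
  refine ⟨ε⁻¹.toNNReal, ?_⟩
  filter_upwards [h2] with n hn
  rw [ENNReal.coe_toNNReal (ENNReal.inv_ne_top.2 hε0), ← eLpNorm_mul_ofReal]
  by_contra! hlt
  have h3 : 1 ≤ ε * eLpNorm (fun ω => b n * (X n ω : ℂ)) 2 P := by
    rw [← ENNReal.mul_inv_cancel hε0 hεt]
    gcongr
  have h4 : P {ω | ‖b n * (X n ω : ℂ)‖ₑ < 1} ≤ 1 / 8 :=
    (measure_mono fun ω hω => lt_of_lt_of_le hω h3).trans
      (hε _ (hasGaussianParts_mul_ofReal hX hc (b n) n))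
  have h5 : (1 : ℝ≥0∞) < 1 / 2 + 1 / 8 := by
    calc (1 : ℝ≥0∞) = P Set.univ := measure_univ.symm
      _ ≤ P ({ω | 1 ≤ edist (b n * (X n ω : ℂ)) 0} ∪ {ω | ‖b n * (X n ω : ℂ)‖ₑ < 1}) := by
          refine measure_mono fun ω _ => ?_
          rcases le_or_gt 1 ‖b n * (X n ω : ℂ)‖ₑ with h | h
          · exact Or.inl (by simpa [edist_zero_right] using h)
          · exact Or.inr h
      _ ≤ _ := measure_union_le _ _
      _ < _ := ENNReal.add_lt_add_of_lt_of_le (by simp) hn h4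
  have h6 : (1 / 2 + 1 / 8 : ℝ≥0∞) ≤ 1 := by
    rw [← ENNReal.toReal_le_toReal (by simp) (by simp), ENNReal.toReal_add (by simp) (by simp)]
    norm_num
  exact absurd h5 h6.not_gt

/-- The test function `∑ z ^ n / (n + 1)` shows that the standard deviations grow slowly. -/
lemma HasLpProperty.hasTemperedGrowth (hX : IsGaussianProcess X P)
    (hc : ∀ n, ∫ ω, X n ω ∂P = 0) {p : ℝ≥0∞} (h : HasLpProperty X P p) :
    HasTemperedGrowth X P := by
  have := hX.isProbabilityMeasure
  intro r h0 h1
  obtain ⟨R, hrR, hR1⟩ := exists_between h1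
  have hR0 : 0 < R := h0.trans_lt hrR
  let a : ℕ → ℂ := fun n => ((1 / ((n : ℝ) + 1) : ℝ) : ℂ)
  have hnorm : ∀ n, ‖a n‖ = 1 / ((n : ℝ) + 1) := fun n => by
    rw [Complex.norm_real, Real.norm_of_nonneg (by positivity)]
  have ha : ∑' n, ‖a n‖ₑ ^ 2 ≠ ∞ := by
    have hs : Summable fun n : ℕ => ‖a n‖ ^ 2 := by
      have := (summable_nat_add_iff 1).2 (Real.summable_one_div_nat_pow.2 one_lt_two)
      simpa [hnorm] using this
    have := hs.tsum_ofReal_ne_top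
    simpa only [ENNReal.ofReal_pow (norm_nonneg _), ofReal_norm] using this
  obtain ⟨hconv, hmem⟩ := memHardy_two_powerSum ha
  have hz : ∀ᵐ ω ∂P, Tendsto (fun n => a n * (R : ℂ) ^ n * (X n ω : ℂ)) atTop (𝓝 0) := by
    filter_upwards [h _ hmem] with ω hω
    have h2 := hω.1 R (by simpa [abs_of_pos hR0] using hR1)
    have h3 : randomTerm X (powerSum a) ω R = fun n => a n * (R : ℂ) ^ n * (X n ω : ℂ) := by
      ext n
      rw [randomTerm, taylorCoeff_powerSum hconv]
      ring
    rw [h3] at h2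
    exact h2.tendsto_atTop_zero
  obtain ⟨C, hC⟩ := exists_eventually_eLpNorm_le hX hc hz
  have hfin : ∀ n, eLpNorm (X n) 2 P ≠ ∞ := fun n =>
    (hX.hasGaussianLaw_eval n).memLp_two.eLpNorm_ne_top
  have hsum : Summable fun n => r ^ n * (eLpNorm (X n) 2 P).toReal := by
    have hq : ‖r / R‖ < 1 := by
      rw [Real.norm_of_nonneg (by positivity), div_lt_one hR0]; exact hrR
    have h2 : Summable fun n : ℕ => (C : ℝ) * (((n : ℝ) ^ 1 + 1) * (r / R) ^ n) := by
      have h3 := summable_pow_mul_geometric_of_norm_lt_one 1 hq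
      have h4 := summable_geometric_of_norm_lt_one hq
      exact ((h3.add h4).congr fun n => by ring).mul_left _
    -- The factor `n + 1` undoes the coefficient `1 / (n + 1)` of the test function.
    refine Summable.of_norm_bounded_eventually_nat h2 ?_
    filter_upwards [hC] with n hn
    have h3 : ‖a n * (R : ℂ) ^ n‖ * (eLpNorm (X n) 2 P).toReal ≤ C := by
      have := ENNReal.toReal_mono ENNReal.coe_ne_top hn
      simpa using this
    rw [norm_mul, hnorm, norm_pow, Complex.norm_real, Real.norm_of_nonneg hR0.le] at h3
    rw [Real.norm_of_nonneg (by positivity)]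
    calc r ^ n * (eLpNorm (X n) 2 P).toReal
        = ((n : ℝ) ^ 1 + 1) * (r / R) ^ n *
          (1 / ((n : ℝ) + 1) * R ^ n * (eLpNorm (X n) 2 P).toReal) := by
          rw [div_pow]; field_simp
      _ ≤ ((n : ℝ) ^ 1 + 1) * (r / R) ^ n * C := by gcongr
      _ = _ := by ring
  have := hsum.tsum_ofReal_ne_top
  simpa only [ENNReal.ofReal_mul (pow_nonneg h0 _), ENNReal.ofReal_pow h0,
    ENNReal.ofReal_toReal (hfin _), Real.enorm_of_nonneg h0] using this

/-- Almost sure membership of `R f` in `H^p` bounds the deviations of `R f` over all circles: on an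
event of probability at least `1/2` the norm of `R f` is at most `m`, and by the small ball
estimate such an event captures a fixed proportion of the size of each Gaussian value. -/
lemma HasLpProperty.exists_circleDeviation_le (hX : IsGaussianProcess X P)
    (hc : ∀ n, ∫ ω, X n ω ∂P = 0) {p : ℝ≥0∞} (hp1 : 1 ≤ p) (hp : p ≠ ∞)
    (h : HasLpProperty X P p) {f : ℂ → ℂ} (hf : MemHardy 2 f) :
    ∃ C : ℝ≥0, ∀ k, circleDeviation X P p (radius k) (taylorCoeff f) ≤ C := by
  have := hX.isProbabilityMeasure
  have hg := h.hasTemperedGrowth hX hc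
  have ha := isBoundedSeq_taylorCoeff hf
  have hp0 : p ≠ 0 := (zero_lt_one.trans_le hp1).ne'
  have hp' : 0 < p.toReal := ENNReal.toReal_pos hp0 hp
  obtain ⟨ε, hε0, hεt, hε⟩ := exists_measure_enorm_lt_le P
  obtain ⟨m, hm⟩ : ∃ m : ℕ, 1 / 2 ≤ P {ω | hardyNorm p (randomization X f ω) ≤ m} := by
    have hmono : Monotone fun m : ℕ => {ω | hardyNorm p (randomization X f ω) ≤ m} :=
      fun i j hij ω hω => by
        have hij' : (i : ℝ≥0∞) ≤ j := by exact_mod_cast hij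
        exact le_trans (Set.mem_ofPred_eq.mp hω) hij'
    have hU : P (⋃ m : ℕ, {ω | hardyNorm p (randomization X f ω) ≤ m}) = 1 := by
      rw [← measure_univ (μ := P)]
      refine measure_congr (eventuallyEq_set.2 ?_)
      filter_upwards [h f hf] with ω hω
      obtain ⟨m, hm⟩ := ENNReal.exists_nat_gt hω.2.norm_lt_top.ne
      simp only [Set.mem_iUnion, Set.mem_univ, iff_true]
      exact ⟨m, hm.le⟩
    have ht := tendsto_measure_iUnion_atTop (μ := P) hmono
    rw [hU] at ht
    obtain ⟨m, hm⟩ := (ht.eventually (lt_mem_nhds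
      (show (1 / 2 : ℝ≥0∞) < 1 by simp))).exists
    exact ⟨m, hm.le⟩
  have hεp : ε ^ p.toReal ≠ 0 := fun h0 => hε0 ((ENNReal.rpow_eq_zero_iff_of_pos hp').1 h0)
  have hεpt : ε ^ p.toReal ≠ ∞ := ENNReal.rpow_ne_top_of_nonneg hp'.le hεt
  let c : ℝ≥0∞ := ε ^ p.toReal * (1 / 4)
  have hc0 : c ≠ 0 := mul_ne_zero hεp (by simp)
  have hct : c ≠ ∞ := ENNReal.mul_ne_top hεpt (by simp)
  let D : ℝ≥0∞ := (c⁻¹ * (m : ℝ≥0∞) ^ p.toReal) ^ (1 / p.toReal)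
  have hD : D ≠ ∞ := ENNReal.rpow_ne_top_of_nonneg (by positivity)
    (ENNReal.mul_ne_top (ENNReal.inv_ne_top.2 hc0)
      (ENNReal.rpow_ne_top_of_nonneg hp'.le (by simp)))
  refine ⟨D.toNNReal, fun k => ?_⟩
  rw [ENNReal.coe_toNNReal hD]
  let Y : Ω → ℝ → ℂ := fun ω θ => randomValue X (taylorCoeff f) (circleMap 0 (radius k) θ) ω
  have hYm : AEMeasurable (Function.uncurry Y) (P.prod arcMeasure) :=
    aemeasurable_uncurry_randomValue hX.aemeasurable hg ha (radius_mem k).1.le (radius_mem k).2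
  have hsq : ∀ θ, IsSquareConvergent X P fun n => taylorCoeff f n * circleMap 0 (radius k) θ ^ n :=
    fun θ => ha.isSquareConvergent hg
      (by simpa using circleMap_zero_mem_ball (radius_mem k).1.le (radius_mem k).2 θ)
  let G : Ω → ℝ≥0∞ := fun ω => ∫⁻ θ, ‖Y ω θ‖ₑ ^ p.toReal ∂arcMeasure
  have hGm : AEMeasurable G P :=
    AEMeasurable.lintegral_prod_right' (f := fun z : Ω × ℝ => ‖Y z.1 z.2‖ₑ ^ p.toReal)
      (hYm.enorm.pow_const p.toReal)
  let B : Set Ω := {ω | G ω ≤ (m : ℝ≥0∞) ^ p.toReal}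
  have hBm : NullMeasurableSet B P := nullMeasurableSet_le hGm aemeasurable_const
  have hB : 1 / 2 ≤ P B := by
    refine hm.trans (measure_mono fun ω hω => ?_)
    have h1 : eLpNorm (Y ω) p arcMeasure ≤ m := by
      refine le_trans (le_of_eq ?_) ((le_iSup₂ (f := fun (r : ℝ) (_ : r ∈ Set.Ioo (0 : ℝ) 1) =>
        eLpNorm (fun θ : ℝ => randomization X f ω (circleMap 0 r θ)) p arcMeasure)
        (radius k) (radius_mem k)).trans hω)
      congr 1
      ext θ
      exact randomValue_eq_powerSum _ _ _
    rw [eLpNorm_eq_lintegral_rpow_enorm_toReal hp0 hp, one_div, ENNReal.rpow_inv_le_iff hp'] at h1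
    exact h1
  have hlow : ∀ θ, c * eLpNorm (fun ω => Y ω θ) 2 P ^ p.toReal ≤
      ∫⁻ ω in B, ‖Y ω θ‖ₑ ^ p.toReal ∂P := fun θ => by
    have hYθ : AEMeasurable (fun ω => Y ω θ) P := aemeasurable_randomSum hX.aemeasurable (hsq θ)
    have hN : NullMeasurableSet {ω | ε * eLpNorm (fun ω => Y ω θ) 2 P ≤ ‖Y ω θ‖ₑ} P :=
      nullMeasurableSet_le aemeasurable_const hYθ.enorm
    have h1 : 1 / 4 ≤ P ({ω | ε * eLpNorm (fun ω => Y ω θ) 2 P ≤ ‖Y ω θ‖ₑ} ∩ B) := by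
      have h2 : P B ≤ P ({ω | ε * eLpNorm (fun ω => Y ω θ) 2 P ≤ ‖Y ω θ‖ₑ} ∩ B) +
          P {ω | ‖Y ω θ‖ₑ < ε * eLpNorm (fun ω => Y ω θ) 2 P} := by
        refine (measure_mono fun ω hω => ?_).trans (measure_union_le _ _)
        rcases le_or_gt (ε * eLpNorm (fun ω => Y ω θ) 2 P) ‖Y ω θ‖ₑ with h | h
        · exact Or.inl ⟨h, hω⟩
        · exact Or.inr h
      have h3 := hε _ (hasGaussianParts_randomSum hX hc (hsq θ))
      have h4 := hB.trans (h2.trans (add_le_add_right h3 _))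
      -- The event `B` exceeds the small ball by more than `1 / 4` in probability.
      have h5 : (1 / 4 : ℝ≥0∞) + 1 / 8 ≤ 1 / 2 := by
        rw [← ENNReal.toReal_le_toReal (by simp) (by simp), ENNReal.toReal_add (by simp) (by simp)]
        norm_num
      exact (ENNReal.add_le_add_iff_right (by simp)).1 (h5.trans h4)
    have h2 := mul_meas_ge_le_lintegral₀ (μ := P.restrict B)
      ((hYθ.enorm.pow_const p.toReal).restrict) ((ε * eLpNorm (fun ω => Y ω θ) 2 P) ^ p.toReal)
    simp only [ENNReal.rpow_le_rpow_iff hp'] at h2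
    rw [Measure.restrict_apply₀ (hN.mono_ac Measure.restrict_le_self.absolutelyContinuous)] at h2
    refine le_trans ?_ h2
    rw [ENNReal.mul_rpow_of_nonneg _ _ hp'.le]
    calc c * eLpNorm (fun ω => Y ω θ) 2 P ^ p.toReal
        = ε ^ p.toReal * eLpNorm (fun ω => Y ω θ) 2 P ^ p.toReal * (1 / 4) := by
          simp only [c]; ring
      _ ≤ _ := by gcongr
  have hswap : AEMeasurable (Function.uncurry fun ω θ => ‖Y ω θ‖ₑ ^ p.toReal)
      ((P.restrict B).prod arcMeasure) := by
    have h1 : (P.restrict B).prod arcMeasure = (P.prod arcMeasure).restrict (B ×ˢ Set.univ) := by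
      rw [← Measure.prod_restrict, Measure.restrict_univ]
    rw [h1]
    exact (hYm.enorm.pow_const p.toReal).restrict
  have hint : c * ∫⁻ θ, eLpNorm (fun ω => Y ω θ) 2 P ^ p.toReal ∂arcMeasure ≤
      (m : ℝ≥0∞) ^ p.toReal := by
    calc c * ∫⁻ θ, eLpNorm (fun ω => Y ω θ) 2 P ^ p.toReal ∂arcMeasure
        = ∫⁻ θ, c * eLpNorm (fun ω => Y ω θ) 2 P ^ p.toReal ∂arcMeasure :=
          (lintegral_const_mul' _ _ hct).symm
      _ ≤ ∫⁻ θ, ∫⁻ ω in B, ‖Y ω θ‖ₑ ^ p.toReal ∂P ∂arcMeasure := lintegral_mono hlow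
      _ = ∫⁻ ω in B, G ω ∂P := (lintegral_lintegral_swap hswap).symm
      _ ≤ ∫⁻ ω in B, (m : ℝ≥0∞) ^ p.toReal ∂P := by
          refine lintegral_mono_ae ?_
          filter_upwards [ae_restrict_mem₀ hBm] with ω hω using hω
      _ ≤ (m : ℝ≥0∞) ^ p.toReal := by
          rw [lintegral_const]
          refine mul_le_of_le_one_right' ?_
          rw [Measure.restrict_apply_univ]
          exact prob_le_one
  rw [circleDeviation, eLpNorm_eq_lintegral_rpow_enorm_toReal hp0 hp]
  refine ENNReal.rpow_le_rpow ?_ (by positivity)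
  rw [mul_comm c⁻¹, ← div_eq_mul_inv, ENNReal.le_div_iff_mul_le (Or.inl hc0) (Or.inl hct), mul_comm]
  exact hint

lemma circleDeviation_add_le (hX : ∀ n, AEMeasurable (X n) P) [SFinite P]
    (hg : HasTemperedGrowth X P) {p : ℝ≥0∞} (hp1 : 1 ≤ p) {r : ℝ} (h0 : 0 ≤ r) (h1 : r < 1)
    {a b : ℕ → ℂ} (ha : IsBoundedSeq a) (hb : IsBoundedSeq b) :
    circleDeviation X P p r (a + b) ≤ circleDeviation X P p r a + circleDeviation X P p r b := by
  have hm : ∀ {c : ℕ → ℂ}, IsBoundedSeq c → AEStronglyMeasurable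
      (fun θ : ℝ => eLpNorm (randomValue X c (circleMap 0 r θ)) 2 P) arcMeasure := fun hc => by
    have := aemeasurable_uncurry_randomValue hX hg hc h0 h1
    simp only [eLpNorm_eq_lintegral_rpow_enorm_toReal two_ne_zero ENNReal.ofNat_ne_top]
    exact ((AEMeasurable.lintegral_prod_left' (this.enorm.pow_const _)).pow_const
      _).aestronglyMeasurable
  refine le_trans (eLpNorm_mono_enorm fun θ => ?_) (eLpNorm_add_le (hm ha) (hm hb) hp1)
  simp only [enorm_eq_self, Pi.add_apply]
  have hz : ‖circleMap 0 r θ‖ < 1 := by simpa using circleMap_zero_mem_ball h0 h1 θ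
  have hsa := ha.isSquareConvergent hg hz
  have hsb := hb.isSquareConvergent hg hz
  refine le_trans (le_of_eq (eLpNorm_congr_ae ?_))
    (eLpNorm_add_le (aemeasurable_randomSum hX hsa).aestronglyMeasurable
      (aemeasurable_randomSum hX hsb).aestronglyMeasurable (by simp))
  filter_upwards [hsa.ae_summable hX, hsb.ae_summable hX] with ω h2 h3
  simp only [Pi.add_apply, randomValue, randomSum]
  rw [← h2.tsum_add h3]
  exact tsum_congr fun n => by ring

lemma circleDeviation_smul_le (p : ℝ≥0∞) (r : ℝ) (c : ℂ) (a : ℕ → ℂ) :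
    circleDeviation X P p r (c • a) ≤ ‖c‖ₑ * circleDeviation X P p r a := by
  refine eLpNorm_le_mul_eLpNorm_of_ae_le_mul' (c := ‖c‖₊) (ae_of_all _ fun θ => ?_) p
  simp only [enorm_eq_self]
  have : randomValue X (c • a) (circleMap 0 r θ) = c • randomValue X a (circleMap 0 r θ) := by
    ext ω
    simp only [randomValue, randomSum, Pi.smul_apply, smul_eq_mul]
    rw [← tsum_mul_left]
    exact tsum_congr fun n => by ring
  rw [this, eLpNorm_const_smul]
  rfl

lemma circleDeviation_le_of_enorm_le (hX : ∀ n, AEMeasurable (X n) P) {p : ℝ≥0∞} (hp0 : p ≠ 0)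
    (hp : p ≠ ∞) {r : ℝ} {a : ℕ → ℂ} {C : ℝ≥0∞} (ha : ∀ n, ‖a n‖ₑ ≤ C) :
    circleDeviation X P p r a ≤ C * ∑' n, ‖r‖ₑ ^ n * eLpNorm (X n) 2 P := by
  have h2 : ∀ θ, eLpNorm (randomValue X a (circleMap 0 r θ)) 2 P ≤
      C * ∑' n, ‖r‖ₑ ^ n * eLpNorm (X n) 2 P := fun θ => by
    refine (eLpNorm_randomSum_le hX).trans ?_
    rw [← ENNReal.tsum_mul_left]
    refine ENNReal.tsum_le_tsum fun n => ?_
    have h3 : ‖circleMap 0 r θ‖ₑ = ‖r‖ₑ := by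
      rw [← ofReal_norm, ← ofReal_norm, norm_circleMap_zero, Real.norm_eq_abs]
    rw [enorm_mul, enorm_pow, mul_assoc, h3]
    gcongr
    exact ha n
  calc circleDeviation X P p r a
      ≤ eLpNorm (fun _ : ℝ => C * ∑' n, ‖r‖ₑ ^ n * eLpNorm (X n) 2 P) p arcMeasure :=
        eLpNorm_mono_enorm fun θ => by simpa using h2 θ
    _ = _ := by
        rw [eLpNorm_eq_lintegral_rpow_enorm_toReal hp0 hp, lintegral_const, measure_univ, mul_one,
          enorm_eq_self, ← ENNReal.rpow_mul,
          mul_one_div_cancel (ENNReal.toReal_pos hp0 hp).ne', ENNReal.rpow_one]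

lemma tsum_enorm_sq_lp (x : lp (fun _ : ℕ => ℂ) 2) : ∑' n, ‖x n‖ₑ ^ 2 = ‖x‖ₑ ^ 2 := by
  have h := lp.hasSum_norm (p := 2) (by simp) x
  simp only [ENNReal.toReal_ofNat, Real.rpow_ofNat] at h
  rw [← ofReal_norm x, ← ENNReal.ofReal_pow (norm_nonneg _), ← h.tsum_eq,
    ENNReal.ofReal_tsum_of_nonneg (fun n => by positivity) h.summable]
  simp_rw [ENNReal.ofReal_pow (norm_nonneg _), ofReal_norm]

lemma enorm_apply_le_lp (x : lp (fun _ : ℕ => ℂ) 2) (n : ℕ) : ‖x n‖ₑ ≤ ‖x‖ₑ :=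
  enorm_le_iff_norm_le.2 (lp.norm_apply_le_norm two_ne_zero x n)

/-- The uniform boundedness principle for the seminorms `circleDeviation` on `ℓ²` turns the bounds
for individual functions into one bound for the operator. -/
lemma exists_circleDeviation_le_mul (hX : ∀ n, AEMeasurable (X n) P) [SFinite P]
    (hg : HasTemperedGrowth X P) {p : ℝ≥0∞} (hp1 : 1 ≤ p) (hp : p ≠ ∞)
    (h : ∀ f : ℂ → ℂ, MemHardy 2 f →
      ∃ C : ℝ≥0, ∀ k, circleDeviation X P p (radius k) (taylorCoeff f) ≤ C) :
    ∃ C : ℝ≥0, ∀ f : ℂ → ℂ, MemHardy 2 f → ∀ k,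
      circleDeviation X P p (radius k) (taylorCoeff f) ≤ C * hardyNorm 2 f := by
  have hp0 : p ≠ 0 := (zero_lt_one.trans_le hp1).ne'
  let E := lp (fun _ : ℕ => ℂ) 2
  have hbdd : ∀ x : E, IsBoundedSeq x := fun x => ⟨‖x‖₊, enorm_apply_le_lp x⟩
  let S : ℕ → ℝ≥0∞ := fun k => ∑' n, ‖radius k‖ₑ ^ n * eLpNorm (X n) 2 P
  have hS : ∀ k, S k ≠ ∞ := fun k => hg _ (radius_mem k).1.le (radius_mem k).2
  have hle : ∀ k (x : E), circleDeviation X P p (radius k) x ≤ ‖x‖ₑ * S k := fun k x =>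
    circleDeviation_le_of_enorm_le hX hp0 hp (enorm_apply_le_lp x)
  have hfin : ∀ k (x : E), circleDeviation X P p (radius k) x ≠ ∞ := fun k x =>
    ne_top_of_le_ne_top (ENNReal.mul_ne_top (by simp) (hS k)) (hle k x)
  let q : ℕ → Seminorm ℂ E := fun k =>
    Seminorm.ofSMulLE (fun x : E => (circleDeviation X P p (radius k) x).toReal)
      (by
        have := hle k 0
        simp only [enorm_zero, zero_mul, nonpos_iff_eq_zero] at this
        exact congrArg ENNReal.toReal this)
      (fun x y => by
        rw [← ENNReal.toReal_add (hfin k x) (hfin k y)]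
        refine ENNReal.toReal_mono (ENNReal.add_ne_top.2 ⟨hfin k x, hfin k y⟩) ?_
        exact circleDeviation_add_le hX hg hp1 (radius_mem k).1.le (radius_mem k).2
          (hbdd x) (hbdd y))
      (fun c x => by
        rw [← toReal_enorm c, ← ENNReal.toReal_mul]
        exact ENNReal.toReal_mono (ENNReal.mul_ne_top (by simp) (hfin k x))
          (circleDeviation_smul_le p (radius k) c x))
  have hcont : ∀ k, Continuous (q k) := fun k => by
    refine Seminorm.continuous_of_le (q := (S k).toNNReal • normSeminorm ℂ E) ?_ fun x => ?_
    · exact continuous_norm.const_smul _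
    · have := ENNReal.toReal_mono (ENNReal.mul_ne_top (by simp) (hS k)) (hle k x)
      rw [ENNReal.toReal_mul, toReal_enorm, mul_comm] at this
      exact this
  have hB : BddAbove (Set.range q) := by
    rw [Seminorm.bddAbove_range_iff]
    intro x
    obtain ⟨h1, h2⟩ := memHardy_two_powerSum (b := x) (by
      rw [tsum_enorm_sq_lp]
      exact ENNReal.pow_ne_top (by simp))
    obtain ⟨C, hC⟩ := h _ h2
    rw [taylorCoeff_powerSum h1] at hC
    refine ⟨C, ?_⟩
    rintro _ ⟨k, rfl⟩
    exact ENNReal.toReal_mono ENNReal.coe_ne_top (hC k)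
  obtain ⟨C, hC0, hC⟩ := Seminorm.bound_of_continuous_normedSpace (⨆ k, q k)
    (by rw [Seminorm.coe_iSup_eq hB]; exact Seminorm.continuous_iSup q hcont hB)
  refine ⟨C.toNNReal, fun f hf k => ?_⟩
  have hmem : Memℓp (taylorCoeff f) 2 := by
    refine memℓp_gen ?_
    have h1 := tsum_taylorCoeff_sq_ne_top hf
    have h2 := ENNReal.summable_toReal h1
    simpa using h2
  let x : E := ⟨taylorCoeff f, hmem⟩
  have hx : ‖x‖ₑ = hardyNorm 2 f := by
    have h1 : ‖x‖ₑ ^ 2 = hardyNorm 2 f ^ 2 := by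
      rw [← tsum_enorm_sq_lp, hardyNorm_two_sq_eq_tsum_taylorCoeff hf.holomorphic]
    exact le_antisymm ((ENNReal.pow_le_pow_left_iff two_ne_zero).1 h1.le)
      ((ENNReal.pow_le_pow_left_iff two_ne_zero).1 h1.ge)
  have h1 : q k x ≤ C * ‖x‖ := by
    refine le_trans ?_ (hC x)
    rw [Seminorm.iSup_apply hB]
    exact le_ciSup ((Seminorm.bddAbove_range_iff.1 hB) x) k
  rw [← hx, ← ENNReal.ofReal_toReal (hfin k x), ← ofReal_norm]
  refine (ENNReal.ofReal_le_ofReal h1).trans (le_of_eq ?_)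
  rw [ENNReal.ofReal_mul hC0.le]
  rfl

end

end

theorem theorem3p1 {Ω : Type*} [MeasurableSpace Ω] (P : Measure Ω) [IsProbabilityMeasure P]
    (X : ℕ → Ω → ℝ) (hX : IsGaussianProcess X P) (hcentered : ∀ n, ∫ ω, X n ω ∂P = 0) :
    (∀ p : ℝ≥0∞, 1 ≤ p → p ≠ ∞ → (HasLpProperty X P p ↔ RandomizationBounded X P 2 p)) ∧
    (IsBoundedOnEllTwo (covMatrix X P) →
      ∀ p : ℝ≥0∞, 1 ≤ p → p ≠ ∞ → RandomizationBounded X P 2 p) := by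
  refine ⟨fun p hp1 hp => ⟨fun h => ?_, fun h f hf => (h.1 f hf).1⟩, fun hK p hp1 hp =>
    randomizationBounded_of_isBoundedOnEllTwo hX hcentered hK hp1 hp⟩
  have hg := h.hasTemperedGrowth hX hcentered
  obtain ⟨C, hC⟩ := exists_circleDeviation_le_mul hX.aemeasurable hg hp1 hp fun f hf =>
    h.exists_circleDeviation_le hX hcentered hp1 hp hf
  exact randomizationBounded_of_circleDeviation_le hX hcentered hg hp1 hp C hC
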